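/- A (finite) guarded concurrent game model with payoffs (GCGMP) consists of: agents $1,\dots,k$ ($k\ge 1$); a finite non-empty set $S$ of states, each labelled with a finite set of atomic propositions; for each agent $a$ a finite non-empty set $\mathrm{Act}_a$ of actions; a transition function $\mathrm{out}:S\times\prod_a \mathrm{Act}_a\to S$; integer payoffs $\mathrm{payoff}_a(s,\vec\alpha)$; discount factors $d_a\in[0,1]\cap\mathbb{Q}$; and guards $g_a(s,\alpha)$. A guard $g_a(s,\alpha)$ is a Boolean combination of constraints $t_1 * t_2$ with $*\in\{<,\le,=,\ge,>\}$, where $t_1,t_2$ are sums of integer constants and of the variable $v_a$ (the accumulated payoff of $a$); for all $a$, $s$ and every value of $v_a$ at least one action is enabled, i.e. has a true guard. A guard is *state-based* if $v_a$ does not occur in it. A configuration $(s,\vec u)$ is a state with a vector of accumulated payoffs. If the step counter is $l$ and every $\alpha_a$ is enabled at $(s,\vec u)$, the profile $\vec\alpha$ leads to $(\mathrm{out}(s,\vec\alpha),\vec u\,')$ with $u'_a=u_a+d_a^{\,l}\,\mathrm{payoff}_a(s,\vec\alpha)$, and the counter becomes $l+1$. Plays are infinite sequences of such steps, histories are their finite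 initial segments ending in a configuration. A strategy of $a$ maps histories to actions. It is *perfect recall state-based* if it depends only on the sequence of states of the history, and *memoryless state-based* if it depends only on the last state. A strategy used from configuration $c$ with step counter $l$ must prescribe an enabled action at every history that starts in $c$ with step counter $l$. The formulae of NGL are $\varphi::=p\mid \mathsf{ac}\mid\neg\varphi\mid\varphi\wedge\varphi\mid\langle\langle A\rangle\rangle \mathbf{X}\varphi\mid\langle\langle A\rangle\rangle \mathbf{G}\varphi\mid\langle\langle A\rangle\rangle(\varphi\,\mathbf{U}\,\varphi)$, where $A$ is a set of agents and $\mathsf{ac}$ is a constraint $t_1*t_2$ between sums of integer constants and of the variables $v_1,\dots,v_k$. The formula $\langle\langle A\rangle\rangle\gamma$ holds at $c$ with step counter $l$ if the agents in $A$ have perfect recall state-based strategies such that, for all memoryless state-based strategies of the other agents, the resulting play from $c$ satisfies $\gamma$; the other clauses are as usual, and $\mathfrak{M},c\models\varphi$ means truth with step counter $1$. The model checking problem asks, given $\mathfrak M$, an initial configuration $c$ with integer payoffs and an NGL-formula $\varphi$, whether $\mathfrak M,c\models\varphi$. **Proposition.** Model checking NGL over GCGMPs, with perfect recall state-based strategies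 for proponents and memoryless state-based strategies for opponents, is undecidable. It remains undecidable 1. on the instances with 2 agents and formulae that contain neither nested cooperation modalities nor arithmetic constraints, and 2. on the instances with 2 agents, formulae without nested cooperation modalities, and models in which all guards are state-based. (Undecidable on a class of instances: no algorithm gives the right answer on all instances of the class.) -/

import Mathlib

namespace NGL

/-! ### Arithmetic constraints -/

/-- Terms over the variables `V`: built from integer constants and variables by addition. -/
inductive ACTerm (V : Type) : Type
  | const (c : ℤ) : ACTerm V
  | var (v : V) : ACTerm V
  | add (s t : ACTerm V) : ACTerm V

/-- Value of a term under an evaluation of the variables. -/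
def ACTerm.eval {V : Type} (η : V → ℚ) : ACTerm V → ℚ
  | .const c => (c : ℚ)
  | .var v => η v
  | .add s t => s.eval η + t.eval η

/-- No variable occurs in the term. -/
def ACTerm.Closed {V : Type} : ACTerm V → Prop
  | .const _ => True
  | .var _ => False
  | .add s t => s.Closed ∧ t.Closed

/-- The comparison symbols `<`, `≤`, `=`, `≥`, `>`. -/
inductive Cmp : Type
  | lt | le | eq | ge | gt

/-- Meaning of a comparison symbol. -/
def Cmp.Rel : Cmp → ℚ → ℚ → Prop
  | .lt, x, y => x < y
  | .le, x, y => x ≤ y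
  | .eq, x, y => x = y
  | .ge, x, y => x ≥ y
  | .gt, x, y => x > y

/-- Arithmetic constraints `t₁ * t₂`, where `*` is a comparison symbol. -/
structure AC (V : Type) : Type where
  lhs : ACTerm V
  cmp : Cmp
  rhs : ACTerm V

/-- Satisfaction of an arithmetic constraint. -/
def AC.Sat {V : Type} (η : V → ℚ) (c : AC V) : Prop :=
  c.cmp.Rel (c.lhs.eval η) (c.rhs.eval η)

/-- Arithmetic constraint formulae: Boolean combinations of arithmetic constraints. -/
inductive ACF (V : Type) : Type
  | atom (c : AC V) : ACF V
  | neg (g : ACF V) : ACF V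
  | and (g h : ACF V) : ACF V

/-- Satisfaction of an arithmetic constraint formula. -/
def ACF.Sat {V : Type} (η : V → ℚ) : ACF V → Prop
  | .atom c => c.Sat η
  | .neg g => ¬ g.Sat η
  | .and g h => g.Sat η ∧ h.Sat η

/-- No variable occurs in the constraint formula. -/
def ACF.Closed {V : Type} : ACF V → Prop
  | .atom c => c.lhs.Closed ∧ c.rhs.Closed
  | .neg g => g.Closed
  | .and g h => g.Closed ∧ h.Closed

/-! ### Guarded concurrent game models with payoffs -/

/-- A finite guarded concurrent game model with payoffs.  Agents are `Fin nAg`, states `Fin nSt`,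
actions of agent `a` are `Fin (nAct a)`, atomic propositions are natural numbers.  Payoffs are
integers, discount factors are rationals in `[0, 1]` (hence utilities are rationals).
The guard `guard a s α` is an arithmetic constraint formula whose only variable (the element of
`Unit`) stands for the accumulated payoff of agent `a`.  Which actions are available at a state is
expressed by the guards alone. -/
structure GCGMP : Type where
  nAg : ℕ
  nSt : ℕ
  nAct : Fin nAg → ℕ
  out : Fin nSt → (∀ a, Fin (nAct a)) → Fin nSt
  label : Fin nSt → Finset ℕ
  payoff : Fin nAg → Fin nSt → (∀ a, Fin (nAct a)) → ℤ
  guard : ∀ a : Fin nAg, Fin nSt → Fin (nAct a) → ACF Unit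
  disc : Fin nAg → ℚ
  nAg_pos : 0 < nAg
  nSt_pos : 0 < nSt
  nAct_pos : ∀ a, 0 < nAct a
  disc_mem : ∀ a, 0 ≤ disc a ∧ disc a ≤ 1
  /-- At every state and for every accumulated payoff, some action is enabled. -/
  guard_total : ∀ (a : Fin nAg) (s : Fin nSt) (x : ℚ), ∃ α, (guard a s α).Sat (fun _ => x)

namespace GCGMP

/-- All guards are state-based: they do not mention accumulated payoffs. -/
def StateBasedGuards (M : GCGMP) : Prop :=
  ∀ (a : Fin M.nAg) (s : Fin M.nSt) (α : Fin (M.nAct a)), (M.guard a s α).Closed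

/-- Action profiles. -/
abbrev Profile (M : GCGMP) : Type := ∀ a : Fin M.nAg, Fin (M.nAct a)

/-- Configurations: a state with a vector of accumulated payoffs (utilities). -/
abbrev Con (M : GCGMP) : Type := Fin M.nSt × (Fin M.nAg → ℚ)

/-- Action `α` is enabled for agent `a` at configuration `c`. -/
def Enabled (M : GCGMP) (c : M.Con) (a : Fin M.nAg) (α : Fin (M.nAct a)) : Prop :=
  (M.guard a c.1 α).Sat (fun _ => c.2 a)

/-- The configuration reached from `c` by the profile `α` when the step counter is `l`. -/
def nextCon (M : GCGMP) (c : M.Con) (α : M.Profile) (l : ℕ) : M.Con :=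
  (M.out c.1 α, fun a => c.2 a + M.disc a ^ l * (M.payoff a c.1 α : ℚ))

/-- The (partial) configuration transition function, as a relation. -/
def Step (M : GCGMP) (c : M.Con) (α : M.Profile) (l : ℕ) (c' : M.Con) : Prop :=
  (∀ a, M.Enabled c a (α a)) ∧ c' = M.nextCon c α l

/-- `π = c₀ α₀, c₁ α₁, …` is a play that starts in `c` when the step counter is `l`. -/
def IsPlay (M : GCGMP) (c : M.Con) (l : ℕ) (π : ℕ → M.Con × M.Profile) : Prop :=
  (π 0).1 = c ∧ ∀ n, M.Step (π n).1 (π n).2 (l + n) (π (n + 1)).1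

/-- Finite sequences `c₀ α₀, …, cₙ₋₁ αₙ₋₁, cₙ`, the shape of histories. -/
abbrev Hist (M : GCGMP) : Type := List (M.Con × M.Profile) × M.Con

/-- The sequence of states of a history, the last one included. -/
def Hist.states {M : GCGMP} (h : M.Hist) : List (Fin M.nSt) :=
  h.1.map (fun x => x.1.1) ++ [h.2.1]

/-- `h` is a history (a finite initial segment of a play) that starts in `c` when the step counter
is `l`. -/
def IsHist (M : GCGMP) (c : M.Con) (l : ℕ) (h : M.Hist) : Prop :=
  ∃ π, M.IsPlay c l π ∧ ∃ n, h = ((List.range n).map π, (π n).1)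

/-! ### Strategies -/

/-- Strategies of agent `a`, before consistency with the guards is required. -/
abbrev Strategy (M : GCGMP) (a : Fin M.nAg) : Type := M.Hist → Fin (M.nAct a)

/-- Consistency with the guards: at every history starting in `c` (with step counter `l`) the
strategy prescribes an enabled action. -/
def Consistent (M : GCGMP) (c : M.Con) (l : ℕ) (a : Fin M.nAg) (σ : M.Strategy a) : Prop :=
  ∀ h, M.IsHist c l h → M.Enabled h.2 a (σ h)

/-- The history obtained by following the complete strategy profile `σ` from `c` for `n` steps,
starting with step counter `l`. -/
def outcomeHist (M : GCGMP) (σ : ∀ a, M.Strategy a) (c : M.Con) (l : ℕ) : ℕ → M.Hist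
  | 0 => ([], c)
  | n + 1 =>
    let h := M.outcomeHist σ c l n
    (h.1 ++ [(h.2, fun a => σ a h)], M.nextCon h.2 (fun a => σ a h) (l + n))

/-- The outcome play of a complete strategy profile. -/
def outcomePlay (M : GCGMP) (σ : ∀ a, M.Strategy a) (c : M.Con) (l : ℕ) :
    ℕ → M.Con × M.Profile :=
  fun n => ((M.outcomeHist σ c l n).2, fun a => σ a (M.outcomeHist σ c l n))

end GCGMP

/-- A class of strategies. -/
abbrev StrategyClass : Type := ∀ (M : GCGMP) (a : Fin M.nAg), Set (M.Strategy a)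

/-- Perfect recall state-based strategies: functions of the sequence of states. -/
def perfectRecall : StrategyClass := fun M a =>
  {σ | ∃ f : List (Fin M.nSt) → Fin (M.nAct a), ∀ h, σ h = f (GCGMP.Hist.states h)}

/-- Memoryless state-based strategies: functions of the last state. -/
def memoryless : StrategyClass := fun M a =>
  {σ | ∃ f : Fin M.nSt → Fin (M.nAct a), ∀ h, σ h = f h.2.1}

/-! ### The logic NGL -/

/-- Formulae of NGL for `k` agents: atomic propositions, arithmetic constraints over the utilities
of the agents, Boolean connectives, and `⟨⟨A⟩⟩ X φ`, `⟨⟨A⟩⟩ G φ`, `⟨⟨A⟩⟩ (φ U ψ)`. -/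
inductive Formula (k : ℕ) : Type
  | prop (p : ℕ) : Formula k
  | ac (c : AC (Fin k)) : Formula k
  | neg (φ : Formula k) : Formula k
  | and (φ ψ : Formula k) : Formula k
  | coopX (A : Finset (Fin k)) (φ : Formula k) : Formula k
  | coopG (A : Finset (Fin k)) (φ : Formula k) : Formula k
  | coopU (A : Finset (Fin k)) (φ ψ : Formula k) : Formula k

/-- No arithmetic constraint occurs in the formula. -/
def Formula.NoArith {k : ℕ} : Formula k → Prop
  | .prop _ => True
  | .ac _ => False
  | .neg φ => φ.NoArith
  | .and φ ψ => φ.NoArith ∧ ψ.NoArith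
  | .coopX _ φ => φ.NoArith
  | .coopG _ φ => φ.NoArith
  | .coopU _ φ ψ => φ.NoArith ∧ ψ.NoArith

/-- No cooperation modality occurs in the formula. -/
def Formula.NoCoop {k : ℕ} : Formula k → Prop
  | .prop _ => True
  | .ac _ => True
  | .neg φ => φ.NoCoop
  | .and φ ψ => φ.NoCoop ∧ ψ.NoCoop
  | .coopX _ _ => False
  | .coopG _ _ => False
  | .coopU _ _ _ => False

/-- No cooperation modality occurs in the scope of another one. -/
def Formula.NoNesting {k : ℕ} : Formula k → Prop
  | .prop _ => True
  | .ac _ => True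
  | .neg φ => φ.NoNesting
  | .and φ ψ => φ.NoNesting ∧ ψ.NoNesting
  | .coopX _ φ => φ.NoCoop
  | .coopG _ φ => φ.NoCoop
  | .coopU _ φ ψ => φ.NoCoop ∧ ψ.NoCoop

namespace GCGMP

/-- At `c`, with step counter `l`, the coalition `A` has a collective `Sp`-strategy such that
against all collective `So`-strategies of the other agents the outcome play satisfies `Γ`. -/
def Coop (M : GCGMP) (Sp So : StrategyClass) (A : Finset (Fin M.nAg)) (c : M.Con) (l : ℕ)
    (Γ : (ℕ → M.Con × M.Profile) → Prop) : Prop :=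
  ∃ σ : ∀ a : {a : Fin M.nAg // a ∈ A}, M.Strategy a,
    (∀ a : {a : Fin M.nAg // a ∈ A}, σ a ∈ Sp M a ∧ M.Consistent c l a (σ a)) ∧
    ∀ τ : ∀ a : {a : Fin M.nAg // a ∉ A}, M.Strategy a,
      (∀ a : {a : Fin M.nAg // a ∉ A}, τ a ∈ So M a ∧ M.Consistent c l a (τ a)) →
      Γ (M.outcomePlay (fun a => if h : a ∈ A then σ ⟨a, h⟩ else τ ⟨a, h⟩) c l)

/-- Truth of a formula at a configuration, with step counter `l`. -/
def Sat (M : GCGMP) (Sp So : StrategyClass) : Formula M.nAg → M.Con → ℕ → Prop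
  | .prop p, c, _ => p ∈ M.label c.1
  | .ac t, c, _ => t.Sat c.2
  | .neg φ, c, l => ¬ M.Sat Sp So φ c l
  | .and φ ψ, c, l => M.Sat Sp So φ c l ∧ M.Sat Sp So ψ c l
  | .coopX A φ, c, l => M.Coop Sp So A c l fun π => M.Sat Sp So φ (π 1).1 (l + 1)
  | .coopG A φ, c, l => M.Coop Sp So A c l fun π => ∀ i, M.Sat Sp So φ (π i).1 (l + i)
  | .coopU A φ ψ, c, l => M.Coop Sp So A c l fun π =>
      ∃ j, M.Sat Sp So ψ (π j).1 (l + j) ∧ ∀ i < j, M.Sat Sp So φ (π i).1 (l + i)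

end GCGMP

/-! ### The model checking problem -/

/-- An instance of the model checking problem: a finite model, an initial configuration (a state
and a vector of integers), and a formula. -/
structure Instance : Type where
  M : GCGMP
  state : Fin M.nSt
  util : Fin M.nAg → ℤ
  φ : Formula M.nAg

/-- The instance is positive: the formula is true at the initial configuration, where the step
counter starts with `1`. -/
def Instance.Holds (Sp So : StrategyClass) (I : Instance) : Prop :=
  I.M.Sat Sp So I.φ (I.state, fun a => (I.util a : ℚ)) 1

/-! ### Instances as inputs of algorithms

An instance is written as a list of natural numbers: trees in prefix notation, functions as tables.
All these codes are prefix-free, so that the code determines the instance. -/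

/-- A code is prefix-free. -/
def PrefixCode {α : Type} (c : α → List ℕ) : Prop :=
  ∀ x y r r', c x ++ r = c y ++ r' → x = y ∧ r = r'

/-- Concatenation of finitely many codes. -/
def table {n : ℕ} (f : Fin n → List ℕ) : List ℕ := (List.ofFn f).flatten

/-- Code of an integer: positive and negative part. -/
def codeInt (z : ℤ) : List ℕ := [z.toNat, (-z).toNat]

/-- Code of a rational number: numerator and denominator. -/
def codeRat (q : ℚ) : List ℕ := codeInt q.num ++ [q.den]

/-- Code of a finite set of numbers: its size and its elements in increasing order. -/
def codeFinset (s : Finset ℕ) : List ℕ := (s.sort (· ≤ ·)).length :: s.sort (· ≤ ·)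

/-- Code of a coalition: its characteristic vector. -/
def codeCoalition {k : ℕ} (A : Finset (Fin k)) : List ℕ := table fun a => [if a ∈ A then 1 else 0]

/-- Code of a term, where the variables are coded by `v`. -/
def ACTerm.code {V : Type} (v : V → ℕ) : ACTerm V → List ℕ
  | .const c => 0 :: codeInt c
  | .var x => [1, v x]
  | .add s t => 2 :: (s.code v ++ t.code v)

/-- Code of a comparison symbol. -/
def Cmp.code : Cmp → ℕ
  | .lt => 0
  | .le => 1
  | .eq => 2
  | .ge => 3
  | .gt => 4

/-- Code of an arithmetic constraint. -/
def AC.code {V : Type} (v : V → ℕ) (c : AC V) : List ℕ :=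
  c.cmp.code :: (c.lhs.code v ++ c.rhs.code v)

/-- Code of an arithmetic constraint formula. -/
def ACF.code {V : Type} (v : V → ℕ) : ACF V → List ℕ
  | .atom c => 0 :: c.code v
  | .neg g => 1 :: g.code v
  | .and g h => 2 :: (g.code v ++ h.code v)

/-- Code of a formula. -/
def Formula.code {k : ℕ} : Formula k → List ℕ
  | .prop p => [0, p]
  | .ac c => 1 :: c.code Fin.val
  | .neg φ => 2 :: φ.code
  | .and φ ψ => 3 :: (φ.code ++ ψ.code)
  | .coopX A φ => 4 :: (codeCoalition A ++ φ.code)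
  | .coopG A φ => 5 :: (codeCoalition A ++ φ.code)
  | .coopU A φ ψ => 6 :: (codeCoalition A ++ (φ.code ++ ψ.code))

/-- Code of a function on action profiles, as a table; the profiles are enumerated in mixed radix
notation. -/
def codeProfileFun {k : ℕ} {m : Fin k → ℕ} {α : Type} (c : α → List ℕ)
    (f : (∀ a, Fin (m a)) → α) : List ℕ :=
  table fun j => c (f (finPiFinEquiv.symm j))

/-- Code of a model. -/
def GCGMP.code (M : GCGMP) : List ℕ :=
  [M.nAg] ++ ([M.nSt] ++ (table (fun a => [M.nAct a]) ++
    (table (fun s => codeProfileFun (fun t => [t.val]) (M.out s)) ++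
    (table (fun s => codeFinset (M.label s)) ++
    (table (fun a => table fun s => codeProfileFun codeInt (M.payoff a s)) ++
    (table (fun a => table fun s => table fun α => (M.guard a s α).code fun _ => 0) ++
    table (fun a => codeRat (M.disc a))))))))

/-- Code of an instance. -/
def Instance.code (I : Instance) : List ℕ :=
  I.M.code ++ ([I.state.val] ++ (table (fun a => codeInt (I.util a)) ++ I.φ.code))

theorem PrefixCode.singleton {α : Type} {f : α → ℕ} (hf : Function.Injective f) :
    PrefixCode fun x => [f x] := by
  intro x y r r' h
  simp only [List.cons_append, List.nil_append, List.cons.injEq] at h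
  exact ⟨hf h.1, h.2⟩

theorem PrefixCode.table {n : ℕ} {α : Fin n → Type} {c : ∀ i, α i → List ℕ}
    (hc : ∀ i, PrefixCode (c i)) :
    PrefixCode fun x : ∀ i, α i => NGL.table fun i => c i (x i) := by
  induction n with
  | zero =>
    intro x y r r' h
    exact ⟨funext fun i => i.elim0, by simpa [NGL.table] using h⟩
  | succ n ih =>
    intro x y r r' h
    simp only [NGL.table, List.ofFn_succ, List.flatten_cons, List.append_assoc] at h
    obtain ⟨h0, h1⟩ := hc 0 _ _ _ _ h
    obtain ⟨h2, h3⟩ := ih (c := fun i => c i.succ) (fun i => hc i.succ)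
      (fun i => x i.succ) (fun i => y i.succ) r r' h1
    refine ⟨funext fun i => ?_, h3⟩
    refine Fin.cases h0 (fun j => ?_) i
    exact congrFun h2 j

theorem prefixCode_int : PrefixCode codeInt := by
  intro x y r r' h
  simp only [codeInt, List.cons_append, List.nil_append, List.cons.injEq] at h
  exact ⟨by omega, h.2.2⟩

theorem prefixCode_rat : PrefixCode codeRat := by
  intro x y r r' h
  simp only [codeRat, List.append_assoc] at h
  obtain ⟨h1, h2⟩ := prefixCode_int _ _ _ _ h
  simp only [List.cons_append, List.nil_append, List.cons.injEq] at h2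
  exact ⟨Rat.ext h1 h2.1, h2.2⟩

theorem prefixCode_finset : PrefixCode codeFinset := by
  intro x y r r' h
  simp only [codeFinset, List.cons_append, List.cons.injEq] at h
  obtain ⟨h1, h2⟩ := List.append_inj h.2 h.1
  refine ⟨?_, h2⟩
  rw [← Finset.sort_toFinset x (· ≤ ·), h1, Finset.sort_toFinset]

theorem prefixCode_coalition {k : ℕ} : PrefixCode (codeCoalition (k := k)) := by
  intro A B r r' h
  have hb : Function.Injective fun b : Bool => if b = true then 1 else 0 := by decide
  have := PrefixCode.table (n := k) (fun _ => PrefixCode.singleton hb)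
    (fun a => decide (a ∈ A)) (fun a => decide (a ∈ B)) r r' (by simpa [codeCoalition] using h)
  refine ⟨Finset.ext fun a => ?_, this.2⟩
  simpa using congrFun this.1 a

theorem prefixCode_term {V : Type} {v : V → ℕ} (hv : Function.Injective v) :
    PrefixCode (ACTerm.code v) := by
  intro x
  induction x with
  | const c =>
    intro y r r' h
    cases y <;> simp [ACTerm.code] at h
    obtain ⟨h1, h2⟩ := prefixCode_int _ _ _ _ h
    exact ⟨by rw [h1], h2⟩
  | var x =>
    intro y r r' h
    cases y <;> simp [ACTerm.code] at h
    exact ⟨by rw [hv h.1], h.2⟩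
  | add s t ihs iht =>
    intro y r r' h
    cases y <;> simp [ACTerm.code] at h
    obtain ⟨h1, h2⟩ := ihs _ _ _ h
    obtain ⟨h3, h4⟩ := iht _ _ _ h2
    exact ⟨by rw [h1, h3], h4⟩

theorem Cmp.code_injective : Function.Injective Cmp.code := by
  intro x y h
  cases x <;> cases y <;> simp [Cmp.code] at h ⊢

theorem prefixCode_AC {V : Type} {v : V → ℕ} (hv : Function.Injective v) :
    PrefixCode (AC.code v) := by
  intro ⟨s, c, t⟩ ⟨s', c', t'⟩ r r' h
  simp only [AC.code, List.cons_append, List.append_assoc, List.cons.injEq] at h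
  obtain ⟨h1, h2⟩ := prefixCode_term hv _ _ _ _ h.2
  obtain ⟨h3, h4⟩ := prefixCode_term hv _ _ _ _ h2
  exact ⟨by rw [h1, h3, Cmp.code_injective h.1], h4⟩

theorem prefixCode_ACF {V : Type} {v : V → ℕ} (hv : Function.Injective v) :
    PrefixCode (ACF.code v) := by
  intro x
  induction x with
  | atom c =>
    intro y r r' h
    cases y <;> simp [ACF.code] at h
    obtain ⟨h1, h2⟩ := prefixCode_AC hv _ _ _ _ h
    exact ⟨by rw [h1], h2⟩
  | neg g ih =>
    intro y r r' h
    cases y <;> simp [ACF.code] at h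
    obtain ⟨h1, h2⟩ := ih _ _ _ h
    exact ⟨by rw [h1], h2⟩
  | and s t ihs iht =>
    intro y r r' h
    cases y <;> simp [ACF.code] at h
    obtain ⟨h1, h2⟩ := ihs _ _ _ h
    obtain ⟨h3, h4⟩ := iht _ _ _ h2
    exact ⟨by rw [h1, h3], h4⟩

theorem prefixCode_formula {k : ℕ} : PrefixCode (Formula.code (k := k)) := by
  intro x
  induction x with
  | prop p =>
    intro y r r' h
    cases y <;> simp [Formula.code] at h
    exact ⟨by rw [h.1], h.2⟩
  | ac c =>
    intro y r r' h
    cases y <;> simp [Formula.code] at h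
    obtain ⟨h1, h2⟩ := prefixCode_AC Fin.val_injective _ _ _ _ h
    exact ⟨by rw [h1], h2⟩
  | neg g ih =>
    intro y r r' h
    cases y <;> simp [Formula.code] at h
    obtain ⟨h1, h2⟩ := ih _ _ _ h
    exact ⟨by rw [h1], h2⟩
  | and s t ihs iht =>
    intro y r r' h
    cases y <;> simp [Formula.code] at h
    obtain ⟨h1, h2⟩ := ihs _ _ _ h
    obtain ⟨h3, h4⟩ := iht _ _ _ h2
    exact ⟨by rw [h1, h3], h4⟩
  | coopX A g ih =>
    intro y r r' h
    cases y <;> simp [Formula.code] at h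
    obtain ⟨h0, h⟩ := prefixCode_coalition _ _ _ _ h
    obtain ⟨h1, h2⟩ := ih _ _ _ h
    exact ⟨by rw [h0, h1], h2⟩
  | coopG A g ih =>
    intro y r r' h
    cases y <;> simp [Formula.code] at h
    obtain ⟨h0, h⟩ := prefixCode_coalition _ _ _ _ h
    obtain ⟨h1, h2⟩ := ih _ _ _ h
    exact ⟨by rw [h0, h1], h2⟩
  | coopU A s t ihs iht =>
    intro y r r' h
    cases y <;> simp [Formula.code] at h
    obtain ⟨h0, h⟩ := prefixCode_coalition _ _ _ _ h
    obtain ⟨h1, h2⟩ := ihs _ _ _ h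
    obtain ⟨h3, h4⟩ := iht _ _ _ h2
    exact ⟨by rw [h0, h1, h3], h4⟩

theorem prefixCode_profileFun {k : ℕ} {m : Fin k → ℕ} {α : Type} {c : α → List ℕ}
    (hc : PrefixCode c) : PrefixCode (codeProfileFun (m := m) c) := by
  intro f g r r' h
  obtain ⟨h1, h2⟩ := PrefixCode.table (fun _ => hc)
    (fun j => f (finPiFinEquiv.symm j)) (fun j => g (finPiFinEquiv.symm j)) r r' h
  refine ⟨funext fun p => ?_, h2⟩
  simpa using congrFun h1 (finPiFinEquiv p)

theorem prefixCode_model : PrefixCode GCGMP.code := by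
  intro M M' r r' h
  obtain ⟨nAg, nSt, nAct, out, label, payoff, guard, disc, _, _, _, _, _⟩ := M
  obtain ⟨nAg', nSt', nAct', out', label', payoff', guard', disc', _, _, _, _, _⟩ := M'
  simp only [GCGMP.code, List.append_assoc] at h
  obtain ⟨rfl, h1⟩ := PrefixCode.singleton Function.injective_id _ _ _ _ h
  obtain ⟨rfl, h2⟩ := PrefixCode.singleton Function.injective_id _ _ _ _ h1
  obtain ⟨rfl, h3⟩ := PrefixCode.table
    (fun _ => PrefixCode.singleton Function.injective_id) _ _ _ _ h2
  obtain ⟨rfl, h4⟩ := PrefixCode.table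
    (fun _ => prefixCode_profileFun (PrefixCode.singleton Fin.val_injective)) _ _ _ _ h3
  obtain ⟨rfl, h5⟩ := PrefixCode.table (fun _ => prefixCode_finset) _ _ _ _ h4
  obtain ⟨rfl, h6⟩ := PrefixCode.table
    (fun _ => PrefixCode.table fun _ => prefixCode_profileFun prefixCode_int) _ _ _ _ h5
  obtain ⟨rfl, h7⟩ := PrefixCode.table (fun _ => PrefixCode.table fun _ => PrefixCode.table fun _ =>
    prefixCode_ACF (Function.injective_of_subsingleton _)) _ _ _ _ h6
  obtain ⟨rfl, h8⟩ := PrefixCode.table (fun _ => prefixCode_rat) _ _ _ _ h7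
  exact ⟨rfl, h8⟩

/-- The code determines the instance. -/
theorem Instance.code_injective : Function.Injective Instance.code := by
  intro ⟨M, s, u, φ⟩ ⟨M', s', u', φ'⟩ h
  simp only [Instance.code] at h
  obtain ⟨rfl, h1⟩ := prefixCode_model _ _ _ _ h
  obtain ⟨rfl, h2⟩ := PrefixCode.singleton Fin.val_injective _ _ _ _ h1
  obtain ⟨rfl, h3⟩ := PrefixCode.table (fun _ => prefixCode_int) _ _ _ _ h2
  obtain ⟨rfl, -⟩ := prefixCode_formula φ φ' [] [] (by simpa using h3)
  rfl

/-- Model checking is decidable on the class `P` of instances: some algorithm gives the right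
answer on (the code of) every instance in `P`; on other inputs its answer is irrelevant. -/
def ModelCheckingDecidable (Sp So : StrategyClass) (P : Instance → Prop) : Prop :=
  ∃ D : List ℕ → Prop, ComputablePred D ∧ ∀ I : Instance, P I → (D I.code ↔ I.Holds Sp So)

end NGL

/-!
Reachability is undecidable for some fixed machine with two counters, where only the initial counter
values vary.  Such a machine becomes a game with two agents whose accumulated payoffs are the
counters: all discount factors are `1`, and the payoffs of a transition are what is added to the
counters.  The model and the formula do not depend on the initial values, so the code of the
instance is the code of one number between two constant lists, and an algorithm for model checking
would decide reachability (`not_modelCheckingDecidable`).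

The formula speaks about the grand coalition, so that no opponents are left and `⟨⟨A⟩⟩ (φ U ψ)` says that
the agents can produce a play in which `φ U ψ` holds.  What remains is to make the agents report the
outcomes of the tests of the counters truthfully.

* Without arithmetic constraints in the formula, guards do this: the action of an agent is the sign
  of its accumulated payoff, and only the true sign is enabled.  The model has a single play from
  each configuration, and a strategy that counts the states seen so far can follow it
  (`CounterMachine.sat_guarded`).
* With state-based guards, the agents are free to guess the signs of the next payoffs.  The guesses are
  recorded in the next state, and the formula requires them to be right until an accepting
  state is reached (`CounterMachine.sat_guessing`).

The machine is obtained as follows.  The diagonal of the universal partial recursive function cannot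
be extended to a decidable predicate separating its values `0` and `1`
(`exists_partrec_inseparable`).  Structured register programs compute all partial recursive functions
(`Computes.of_partrec`).  A register content `s` is coded by a number in which the `i`-th prime has
exponent `s i`; a step of a program multiplies this number by a prime, or tests divisibility by one
and divides.  Two counters with sign tests suffice for this (`FractionMachine.toCounter`).  After
computing the value, the machine enters one of two states of rest, according to whether the value is
zero.  Since a deterministic machine cannot come to rest in both, deciding which state is reached
would separate the two values; in particular, nothing has to be shown about computations that
do not terminate.
-/

namespace NGL

open Function

/-! ### Register programs -/

/-- Structured programs over registers holding natural numbers.  `loop i p` repeats `p` while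
register `i` is nonzero; `halt` has no result: it is where a computation comes to rest. -/
inductive Prog : Type
  | inc (i : ℕ) : Prog
  | dec (i : ℕ) : Prog
  | seq (p q : Prog) : Prog
  | loop (i : ℕ) (p : Prog) : Prog
  | halt : Prog
  deriving DecidableEq

/-- `Run p s t`: started with register contents `s`, the program `p` terminates with contents `t`.
Decrements are applied only to nonzero registers. -/
inductive Run : Prog → (ℕ → ℕ) → (ℕ → ℕ) → Prop
  | inc (i : ℕ) (s : ℕ → ℕ) : Run (.inc i) s (update s i (s i + 1))
  | dec (i : ℕ) (s : ℕ → ℕ) : s i ≠ 0 → Run (.dec i) s (update s i (s i - 1))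
  | seq {p q : Prog} {s t u : ℕ → ℕ} : Run p s t → Run q t u → Run (.seq p q) s u
  | loop_zero {i : ℕ} (p : Prog) {s : ℕ → ℕ} : s i = 0 → Run (.loop i p) s s
  | loop_succ {i : ℕ} {p : Prog} {s t u : ℕ → ℕ} :
      s i ≠ 0 → Run p s t → Run (.loop i p) t u → Run (.loop i p) s u

theorem Run.of_eq {p : Prog} {s t s' t' : ℕ → ℕ} (h : Run p s t) (hs : s = s') (ht : t = t') :
    Run p s' t' := hs ▸ ht ▸ h

/-- A loop whose body takes the contents `F (m + 1)` to `F m`, where `m` is what is left in the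
loop register. -/
theorem Run.loop_countdown {i : ℕ} {p : Prog} (F : ℕ → ℕ → ℕ) (hF : ∀ m, F m i = m) (M : ℕ)
    (h : ∀ m < M, Run p (F (m + 1)) (F m)) : Run (.loop i p) (F M) (F 0) := by
  induction M with
  | zero => exact .loop_zero _ (hF 0)
  | succ M ih =>
    exact .loop_succ (by simp [hF]) (h M M.lt_succ_self)
      (ih fun m hm => h m (hm.trans M.lt_succ_self))

/-- Set register `i` to zero. -/
def Prog.clear (i : ℕ) : Prog := .loop i (.dec i)

theorem Run.clear (i : ℕ) (s : ℕ → ℕ) : Run (.clear i) s (update s i 0) :=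
  (Run.loop_countdown (i := i) (p := .dec i) (fun m => update s i m) (by simp) (s i)
    fun m _ => by simpa using Run.dec i (update s i (m + 1)) (by simp)).of_eq (by simp) rfl

/-- Add register `i` to register `j`, setting register `i` to zero. -/
def Prog.move (i j : ℕ) : Prog := .loop i (.seq (.dec i) (.inc j))

theorem Run.move {i j : ℕ} (hij : i ≠ j) (s : ℕ → ℕ) :
    Run (.move i j) s (update (update s i 0) j (s j + s i)) := by
  refine (Run.loop_countdown (i := i) (p := .seq (.dec i) (.inc j))
    (fun m => update (update s i m) j (s j + (s i - m))) (fun m => by simp [hij]) (s i)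
    fun m hm => .seq (.dec _ _ (by simp [hij])) ((Run.inc _ _).of_eq rfl ?_)).of_eq (by simp) (by simp)
  funext x
  simp only [update_apply]
  grind

/-- Add register `i` to register `j`, with the help of the register `k`, which holds zero. -/
def Prog.copy (i j k : ℕ) : Prog :=
  .seq (.loop i (.seq (.dec i) (.seq (.inc j) (.inc k)))) (.move k i)

theorem Run.copy {i j k : ℕ} (hij : i ≠ j) (hik : i ≠ k) (hjk : j ≠ k) {s : ℕ → ℕ} (hk : s k = 0) :
    Run (.copy i j k) s (update s j (s j + s i)) := by
  refine .seq ((Run.loop_countdown (i := i) (p := .seq (.dec i) (.seq (.inc j) (.inc k)))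
    (fun m => update (update (update s i m) j (s j + (s i - m))) k (s i - m))
    (fun m => by simp [hij, hik]) (s i)
    fun m hm => .seq (.dec _ _ (by simp [hij, hik])) (.seq (.inc _ _)
      ((Run.inc _ _).of_eq rfl ?_))).of_eq ?_ rfl) ((Run.move hik.symm _).of_eq rfl ?_)
  all_goals
    funext x
    simp only [update_apply]
    grind

/-- `f` is computed by register programs: for all input registers `a`, every output register `o`
distinct from them and every `k` above all of these, some program that may use the registers from
`k` on as scratch space writes the value of `f` to `o` and leaves everything else unchanged.
Nothing is required where `f` is undefined. -/
def Computes {n : ℕ} (f : List.Vector ℕ n →. ℕ) : Prop :=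
  ∀ (a : Fin n → ℕ) (o k : ℕ), (∀ i, a i < k) → o < k → (∀ i, a i ≠ o) →
    ∃ p, ∀ s : ℕ → ℕ, (∀ j, k ≤ j → s j = 0) → s o = 0 →
      ∀ v ∈ f (List.Vector.ofFn fun i => s (a i)), Run p s (update s o v)

theorem mem_mOfFn {α : Type} {m : ℕ} (g : Fin m → Part α) (w : List.Vector α m) :
    w ∈ List.Vector.mOfFn g ↔ ∀ i, w.get i ∈ g i := by
  induction m with
  | zero => simp [List.Vector.mOfFn, List.Vector.eq_nil]
  | succ m ih =>
    obtain ⟨x, w, rfl⟩ := w.exists_eq_cons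
    simp only [List.Vector.mOfFn, Part.bind_eq_bind, Part.mem_bind_iff, ih, Fin.forall_fin_succ,
      Part.pure_eq_some, Part.mem_some_iff]
    constructor
    · rintro ⟨y, hy, w', hw', h⟩
      obtain ⟨rfl, rfl⟩ : x = y ∧ w = w' := by
        have h1 := congrArg List.Vector.head h
        have h2 := congrArg List.Vector.tail h
        simpa using And.intro h1 h2
      simpa using ⟨hy, hw'⟩
    · intro h
      exact ⟨x, by simpa using h.1, w, by simpa using h.2, rfl⟩

/-- The contents `s`, with `w 0, …, w (j - 1)` written to the registers from `k` on. -/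
def withBlock (k j : ℕ) (w s : ℕ → ℕ) : ℕ → ℕ :=
  fun x => if k ≤ x ∧ x < k + j then w (x - k) else s x

theorem withBlock_succ (k j : ℕ) (w s : ℕ → ℕ) :
    withBlock k (j + 1) w s = update (withBlock k j w s) (k + j) (w j) := by
  funext x
  simp only [withBlock, update_apply]
  grind

theorem withBlock_zero (k : ℕ) (w s : ℕ → ℕ) : withBlock k 0 w s = s := by
  funext x
  simp only [withBlock]
  grind

/-- A program that computes the first `j` of the functions `g i` into consecutive registers. -/
theorem exists_run_withBlock {m n k : ℕ} {g : Fin m → List.Vector ℕ n →. ℕ}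
    (hg : ∀ i, Computes (g i)) {a : Fin n → ℕ} (ha : ∀ i, a i < k) (j : ℕ) (hj : j ≤ m) :
    ∃ p, ∀ s w : ℕ → ℕ, (∀ j, k ≤ j → s j = 0) →
      (∀ i : Fin m, w i ∈ g i (List.Vector.ofFn fun i => s (a i))) →
      Run p s (withBlock k j w s) := by
  induction j with
  | zero =>
    refine ⟨.clear k, fun s w hs _ => (Run.clear k s).of_eq rfl ?_⟩
    rw [withBlock_zero, ← hs k le_rfl, update_eq_self]
  | succ j ih =>
    obtain ⟨p, hp⟩ := ih (Nat.le_of_succ_le hj)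
    obtain ⟨q, hq⟩ := hg ⟨j, hj⟩ a (k + j) (k + m) (fun i => (ha i).trans_le (by omega)) (by omega)
      (fun i => by have := ha i; omega)
    refine ⟨.seq p q, fun s w hs hw => .seq (hp s w hs hw) ?_⟩
    rw [withBlock_succ]
    refine hq _ (fun x hx => ?_) ?_ _ ?_
    · simp only [withBlock]
      rw [if_neg (by omega), hs x (by omega)]
    · simp only [withBlock]
      rw [if_neg (by omega), hs _ (by omega)]
    · convert hw ⟨j, hj⟩ using 4 with i
      simp only [withBlock]
      rw [if_neg (by have := ha i; omega)]

/-- A program that restores the scratch registers overwritten by a block. -/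
theorem exists_run_clearBlock (k j : ℕ) :
    ∃ p, ∀ s w : ℕ → ℕ, (∀ j, k ≤ j → s j = 0) → Run p (withBlock k j w s) s := by
  induction j with
  | zero =>
    refine ⟨.clear k, fun s w hs => (Run.clear k s).of_eq (withBlock_zero _ _ _).symm ?_⟩
    rw [← hs k le_rfl, update_eq_self]
  | succ j ih =>
    obtain ⟨p, hp⟩ := ih
    refine ⟨.seq (.clear (k + j)) p, fun s w hs => .seq ((Run.clear _ _).of_eq rfl ?_) (hp s w hs)⟩
    rw [withBlock_succ, update_idem, update_eq_self_iff]
    simp [withBlock, hs]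

theorem Computes.comp {m n : ℕ} {f : List.Vector ℕ m →. ℕ} {g : Fin m → List.Vector ℕ n →. ℕ}
    (hf : Computes f) (hg : ∀ i, Computes (g i)) :
    Computes fun v => (List.Vector.mOfFn fun i => g i v) >>= f := by
  intro a o k ha ho hao
  obtain ⟨p, hp⟩ := exists_run_withBlock hg ha m le_rfl
  obtain ⟨q, hq⟩ := hf (fun i => k + i) o (k + m) (fun i => by omega) (by omega) (fun i => by omega)
  obtain ⟨r, hr⟩ := exists_run_clearBlock k m
  refine ⟨.seq p (.seq q r), fun s hs hso v hv => ?_⟩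
  obtain ⟨w, hw, hv⟩ := Part.mem_bind_iff.1 hv
  rw [mem_mOfFn] at hw
  -- The values of the inner functions, extended by zero to all indices.
  let w' : ℕ → ℕ := fun x => if h : x < m then w.get ⟨x, h⟩ else 0
  refine .seq (hp s w' hs fun i => by simpa [w'] using hw i) (.seq (hq _ ?_ ?_ v ?_)
    ((hr (update s o v) w' fun j hj => ?_).of_eq ?_ rfl))
  · intro x hx
    simp only [withBlock]
    rw [if_neg (by omega), hs x (by omega)]
  · simp only [withBlock]
    rw [if_neg (by omega), hso]
  · convert hv using 2
    ext i
    simp [withBlock, w']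
  · rw [update_of_ne (by omega), hs j hj]
  · funext x
    simp only [withBlock, update_apply]
    grind

theorem Computes.prec {n : ℕ} {f : List.Vector ℕ n → ℕ} {g : List.Vector ℕ (n + 2) → ℕ}
    (hf : Computes (f : List.Vector ℕ n →. ℕ)) (hg : Computes (g : List.Vector ℕ (n + 2) →. ℕ)) :
    Computes ((fun v : List.Vector ℕ (n + 1) =>
      v.head.rec (f v.tail) fun y IH => g (y ::ᵥ IH ::ᵥ v.tail) : List.Vector ℕ (n + 1) → ℕ) :
        List.Vector ℕ (n + 1) →. ℕ) := by
  intro a o k ha ho hao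
  have ha' : ∀ i : Fin n, a i.succ < k := fun i => ha i.succ
  -- Register `k` holds the value of the recursion, `k + 1` the number of rounds left, `k + 2` the
  -- number of rounds done, and `k + 3` receives the next value.
  obtain ⟨p, hp⟩ := hf (fun i => a i.succ) k (k + 4) (fun i => by have := ha' i; omega) (by omega)
    (fun i => by have := ha' i; omega)
  obtain ⟨q, hq⟩ := hg (Fin.cons (k + 2) (Fin.cons k fun i => a i.succ)) (k + 3) (k + 4)
    (by simp only [Fin.forall_fin_succ, Fin.cons_zero, Fin.cons_succ]
        exact ⟨by omega, by omega, fun i => by have := ha' i; omega⟩) (by omega)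
    (by simp only [Fin.forall_fin_succ, Fin.cons_zero, Fin.cons_succ]
        exact ⟨by omega, by omega, fun i => by have := ha' i; omega⟩)
  refine ⟨.seq p (.seq (.copy (a 0) (k + 1) (k + 3)) (.seq (.loop (k + 1) (.seq (.dec (k + 1))
    (.seq q (.seq (.clear k) (.seq (.move (k + 3) k) (.inc (k + 2))))))) (.seq (.clear (k + 2))
      (.move k o)))), fun s hs hso v hv => ?_⟩
  have h0 := ha 0
  have hs0 := hs k le_rfl
  have hs1 := hs (k + 1) (by omega)
  have hs2 := hs (k + 2) (by omega)
  have hs3 := hs (k + 3) (by omega)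
  set t : List.Vector ℕ n := List.Vector.ofFn fun i => s (a i.succ) with ht
  set R : ℕ → ℕ := fun m => m.rec (f t) fun y IH => g (y ::ᵥ IH ::ᵥ t) with hR
  -- The value of the recursion after `m` rounds is `R m`.
  obtain rfl : v = R (s (a 0)) := by
    simpa [List.Vector.ofFn] using hv
  set M := s (a 0) with hM
  -- The contents when `m` rounds are left.
  let F : ℕ → ℕ → ℕ := fun m =>
    update (update (update s k (R (M - m))) (k + 1) m) (k + 2) (M - m)
  refine .seq (hp s (fun j hj => hs j (by omega)) hs0 (R 0) (by simp [hR, ht]))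
    (.seq ((Run.copy (by omega) (by omega) (by omega) ?_).of_eq rfl (t' := F M) ?_)
    (.seq (Run.loop_countdown F (fun m => by simp [F]) M fun m hm => ?_)
      (.seq (Run.clear _ _) ((Run.move (by omega) _).of_eq rfl ?_))))
  · simp only [update_apply]
    grind
  · funext x
    simp only [F, update_apply]
    grind
  · refine .seq (.dec _ _ (by simp [F])) (.seq (hq _ ?_ ?_ (R (M - m)) ?_) (.seq (.clear _ _)
      (.seq (.move (by omega) _) ((Run.inc _ _).of_eq rfl ?_))))
    · intro j hj
      simp only [F, update_apply]
      have := hs j (by omega)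
      grind
    · simp only [F, update_apply]
      grind
    · have e : M - m = (M - (m + 1)) + 1 := by omega
      rw [e]
      simp only [PFun.coe_val, Part.mem_some_iff, hR, List.Vector.ofFn, Fin.cons_zero, Fin.cons_succ]
      congr 2
      · simp [F]
      · congr 1
        · simp [F, hR]
        · rw [ht]
          congr 1
          funext i
          have := ha' i
          simp only [F, update_apply]
          grind
    · funext x
      simp only [F, update_apply]
      grind
  · funext x
    simp only [F, update_apply]
    grind

theorem Computes.rfind {n : ℕ} {f : List.Vector ℕ (n + 1) → ℕ}
    (hf : Computes (f : List.Vector ℕ (n + 1) →. ℕ)) :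
    Computes fun v : List.Vector ℕ n => Nat.rfind fun y => Part.some (decide (f (y ::ᵥ v) = 0)) := by
  intro a o k ha ho hao
  -- Register `k` holds the current candidate and `k + 1` the value of `f` there.
  obtain ⟨p, hp⟩ := hf (Fin.cons k a) (k + 1) (k + 2)
    (by simp only [Fin.forall_fin_succ, Fin.cons_zero, Fin.cons_succ]
        exact ⟨by omega, fun i => by have := ha i; omega⟩) (by omega)
    (by simp only [Fin.forall_fin_succ, Fin.cons_zero, Fin.cons_succ]
        exact ⟨by omega, fun i => by have := ha i; omega⟩)
  refine ⟨.seq p (.seq (.loop (k + 1) (.seq (.clear (k + 1)) (.seq (.inc k) p))) (.move k o)),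
    fun s hs hso v hv => ?_⟩
  have hs0 := hs k le_rfl
  have hs1 := hs (k + 1) (by omega)
  set t : List.Vector ℕ n := List.Vector.ofFn fun i => s (a i) with ht
  obtain ⟨hv, hlt⟩ := Nat.mem_rfind.1 hv
  have hv : f (v ::ᵥ t) = 0 := by simpa using Part.mem_some_iff.1 hv
  have hlt : ∀ {y}, y < v → f (y ::ᵥ t) ≠ 0 := fun h => by simpa using Part.mem_some_iff.1 (hlt h)
  let F : ℕ → ℕ → ℕ := fun y => update (update s k y) (k + 1) (f (y ::ᵥ t))
  have hpF : ∀ y, Run p (update s k y) (F y) := fun y => by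
    refine hp _ (fun j hj => ?_) ?_ _ ?_
    · rw [update_of_ne (by omega), hs j (by omega)]
    · rw [update_of_ne (by omega), hs1]
    · simp only [PFun.coe_val, Part.mem_some_iff, List.Vector.ofFn, Fin.cons_zero, Fin.cons_succ,
        update_self, ht]
      congr 3
      funext i
      have := ha i
      rw [update_of_ne (by omega)]
  -- The loop leads from every candidate `y ≤ v` to the least zero `v`.
  have hloop : ∀ d y, y + d = v →
      Run (.loop (k + 1) (.seq (.clear (k + 1)) (.seq (.inc k) p))) (F y) (F v) := by
    intro d
    induction d with
    | zero =>
      rintro y rfl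
      exact .loop_zero _ (by simpa [F] using hv)
    | succ d ih =>
      intro y hy
      refine .loop_succ (by simpa [F] using hlt (by omega)) (.seq (.clear _ _)
        (.seq ((Run.inc _ _).of_eq rfl ?_) (hpF (y + 1)))) (ih (y + 1) (by omega))
      funext x
      simp only [F, update_apply]
      grind
  refine .seq ((hpF 0).of_eq ?_ rfl) (.seq (hloop v 0 (by omega))
    ((Run.move (by omega) _).of_eq rfl ?_))
  · rw [← hs0, update_eq_self]
  · funext x
    simp only [F, update_apply]
    grind

theorem Computes.copy {n : ℕ} (i : Fin n) :
    Computes ((fun v => v.get i : List.Vector ℕ n → ℕ) : List.Vector ℕ n →. ℕ) := by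
  intro a o k ha ho hao
  have := ha i
  refine ⟨.copy (a i) o k, fun s hs hso v hv => ?_⟩
  obtain rfl : v = s (a i) := by simpa using hv
  exact (Run.copy (hao i) (by omega) (by omega) (hs k le_rfl)).of_eq rfl (by rw [hso, zero_add])

theorem Computes.of_primrec {n : ℕ} {f : List.Vector ℕ n → ℕ} (hf : Nat.Primrec' f) :
    Computes (f : List.Vector ℕ n →. ℕ) := by
  induction hf with
  | zero =>
    refine fun a o k ha ho hao => ⟨.clear o, fun s hs hso v hv => ?_⟩
    obtain rfl : v = 0 := by simpa using hv
    exact Run.clear o s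
  | succ =>
    intro a o k ha ho hao
    obtain ⟨p, hp⟩ := Computes.copy (0 : Fin 1) a o k ha ho hao
    refine ⟨.seq p (.inc o), fun s hs hso v hv => ?_⟩
    obtain rfl : v = s (a 0) + 1 := by simpa [List.Vector.ofFn] using hv
    exact .seq (hp s hs hso (s (a 0)) (by simp)) ((Run.inc _ _).of_eq rfl (by simp))
  | get i => exact Computes.copy i
  | comp g hf hg ihf ihg =>
    have h := Computes.comp ihf ihg
    simp only [PFun.coe_val, Vector.mOfFn_part_some] at h
    exact (congrArg Computes (funext fun v => (Part.bind_some _ _).symm)).mpr h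
  | prec hf hg ihf ihg => exact Computes.prec ihf ihg

theorem Computes.of_partrec {n : ℕ} {f : List.Vector ℕ n →. ℕ} (hf : Nat.Partrec' f) :
    Computes f := by
  induction hf with
  | prim hf => exact Computes.of_primrec hf
  | comp g hf hg ihf ihg => exact Computes.comp ihf ihg
  | rfind hf ih => exact Computes.rfind ih

/-! ### Machines with two integer counters -/

/-- A deterministic machine with two integer counters.  The only information on the counters that
it can use is their signs: `1` for nonnegative, `0` for negative. -/
structure CounterMachine (Q : Type) : Type where
  next : Q → (Fin 2 → Fin 2) → Q
  add : Q → (Fin 2 → Fin 2) → Fin 2 → ℤ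

namespace CounterMachine

/-- The signs of the counters, as read by a machine. -/
def signs (u : Fin 2 → ℤ) : Fin 2 → Fin 2 := fun a => if 0 ≤ u a then 1 else 0

variable {Q : Type} (M : CounterMachine Q)

/-- One step of the machine; the counters are changed by addition of integer constants. -/
def step (c : Q × (Fin 2 → ℤ)) : Q × (Fin 2 → ℤ) :=
  (M.next c.1 (signs c.2), c.2 + M.add c.1 (signs c.2))

/-- The second configuration is reached from the first one. -/
def Reaches (c c' : Q × (Fin 2 → ℤ)) : Prop := ∃ n, M.step^[n] c = c'

variable {M}

theorem Reaches.refl (c : Q × (Fin 2 → ℤ)) : M.Reaches c c := ⟨0, rfl⟩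

theorem Reaches.of_step {c c' c'' : Q × (Fin 2 → ℤ)} (h : M.step c = c') (h' : M.Reaches c' c'') :
    M.Reaches c c'' := by
  obtain ⟨n, hn⟩ := h'
  exact ⟨n + 1, by rw [iterate_succ_apply, h, hn]⟩

theorem Reaches.trans {c c' c'' : Q × (Fin 2 → ℤ)} (h : M.Reaches c c') (h' : M.Reaches c' c'') :
    M.Reaches c c'' := by
  obtain ⟨m, rfl⟩ := h
  obtain ⟨n, rfl⟩ := h'
  exact ⟨n + m, iterate_add_apply _ _ _ _⟩

/-- A set of states closed under `next` is never left. -/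
theorem iterate_step_mem {S : Set Q} (hS : ∀ q ∈ S, ∀ b, M.next q b ∈ S) {c : Q × (Fin 2 → ℤ)}
    (hc : c.1 ∈ S) (n : ℕ) : (M.step^[n] c).1 ∈ S := by
  induction n with
  | zero => exact hc
  | succ n ih =>
    rw [iterate_succ_apply']
    exact hS _ ih _

variable (M) in
/-- The machine restricted to a closed set of states. -/
def restrict (S : Set Q) (hS : ∀ q ∈ S, ∀ b, M.next q b ∈ S) : CounterMachine S where
  next q b := ⟨M.next q b, hS _ q.2 b⟩
  add q b := M.add q b

theorem iterate_step_restrict {S : Set Q} (hS : ∀ q ∈ S, ∀ b, M.next q b ∈ S) (q : S)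
    (u : Fin 2 → ℤ) (n : ℕ) :
    Prod.map Subtype.val id ((M.restrict S hS).step^[n] (q, u)) = M.step^[n] (q.1, u) :=
  (Semiconj.iterate_right (f := Prod.map Subtype.val id) (ga := (M.restrict S hS).step)
    (gb := M.step) (fun _ => rfl) n) (q, u)

end CounterMachine

/-! ### Multiplication and division with two counters -/

/-- A machine that acts on one natural number: in state `q`, a number `N` divisible by `div q` is
replaced by `N / div q * mul q`, and the state becomes `yes q`; otherwise `N` remains and the state
becomes `no q`. -/
structure FractionMachine (Q : Type) : Type where
  div : Q → ℕ
  mul : Q → ℕ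
  yes : Q → Q
  no : Q → Q

namespace FractionMachine

variable {Q : Type} (F : FractionMachine Q)

/-- Simulation of a fraction machine by a counter machine.  Phase `0` divides the first counter
by `d = div q` through repeated subtraction, counting in the second one, until the first one is
negative; it then holds the remainder minus `d`, and the second one exceeds the quotient by one.
Subtracting `2` from the latter leaves the quotient minus one, whose sign tells whether the
quotient is zero; in the same way, phase `1` reads off from the sign of the remainder
minus one whether the remainder is zero.  The phases `2` and `3` multiply the quotient by `mul q`
and by `d`, respectively. -/
def toCounter : CounterMachine (Q × Fin 4) where
  next p b :=
    match p.2 with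
    | 0 => if b 0 = 1 then (p.1, 0) else (p.1, 1)
    | 1 => if b 0 = 1 then (p.1, 3) else (p.1, 2)
    | 2 => if b 1 = 1 then (p.1, 2) else (F.yes p.1, 0)
    | 3 => if b 1 = 1 then (p.1, 3) else (F.no p.1, 0)
  add p b :=
    match p.2 with
    | 0 => if b 0 = 1 then ![-F.div p.1, 1] else ![F.div p.1 - 1, -2]
    | 1 => ![1, 0]
    | 2 => if b 1 = 1 then ![F.mul p.1, -1] else ![0, 1]
    | 3 => if b 1 = 1 then ![F.div p.1, -1] else ![0, 1]

open CounterMachine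

theorem step_eq (q : Q) (i : Fin 4) (x y : ℤ) : F.toCounter.step ((q, i), ![x, y]) =
    (F.toCounter.next (q, i) (signs ![x, y]),
      ![x + F.toCounter.add (q, i) (signs ![x, y]) 0,
        y + F.toCounter.add (q, i) (signs ![x, y]) 1]) := by
  refine Prod.ext rfl (funext fun a => ?_)
  fin_cases a <;> rfl

theorem step_divide_of_nonneg (q : Q) {x : ℤ} (y : ℤ) (h : 0 ≤ x) :
    F.toCounter.step ((q, 0), ![x, y]) = ((q, 0), ![x - F.div q, y + 1]) := by
  rw [step_eq]
  simp [toCounter, signs, h, sub_eq_add_neg]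

theorem step_divide_of_neg (q : Q) {x : ℤ} (y : ℤ) (h : x < 0) :
    F.toCounter.step ((q, 0), ![x, y]) = ((q, 1), ![x + (F.div q - 1), y - 2]) := by
  rw [step_eq]
  simp [toCounter, signs, h.not_ge, sub_eq_add_neg]

theorem step_test_of_nonneg (q : Q) {x : ℤ} (y : ℤ) (h : 0 ≤ x) :
    F.toCounter.step ((q, 1), ![x, y]) = ((q, 3), ![x + 1, y]) := by
  rw [step_eq]
  simp [toCounter, signs, h]

theorem step_test_of_neg (q : Q) {x : ℤ} (y : ℤ) (h : x < 0) :
    F.toCounter.step ((q, 1), ![x, y]) = ((q, 2), ![x + 1, y]) := by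
  rw [step_eq]
  simp [toCounter, signs, h.not_ge]

theorem step_yes_of_nonneg (q : Q) (x : ℤ) {y : ℤ} (h : 0 ≤ y) :
    F.toCounter.step ((q, 2), ![x, y]) = ((q, 2), ![x + F.mul q, y - 1]) := by
  rw [step_eq]
  simp [toCounter, signs, h, sub_eq_add_neg]

theorem step_yes_of_neg (q : Q) (x : ℤ) {y : ℤ} (h : y < 0) :
    F.toCounter.step ((q, 2), ![x, y]) = ((F.yes q, 0), ![x, y + 1]) := by
  rw [step_eq]
  simp [toCounter, signs, h]

theorem step_no_of_nonneg (q : Q) (x : ℤ) {y : ℤ} (h : 0 ≤ y) :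
    F.toCounter.step ((q, 3), ![x, y]) = ((q, 3), ![x + F.div q, y - 1]) := by
  rw [step_eq]
  simp [toCounter, signs, h, sub_eq_add_neg]

theorem step_no_of_neg (q : Q) (x : ℤ) {y : ℤ} (h : y < 0) :
    F.toCounter.step ((q, 3), ![x, y]) = ((F.no q, 0), ![x, y + 1]) := by
  rw [step_eq]
  simp [toCounter, signs, h]

/-- Division of `t * d + r` by `d = div q`: the first counter ends with the remainder minus one, the
second one has grown by the quotient minus one. -/
theorem reaches_divide {q : Q} {r : ℤ} (hr : 0 ≤ r) (hd : r < F.div q) (t : ℕ) (y : ℤ) :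
    F.toCounter.Reaches ((q, 0), ![r + t * F.div q, y]) ((q, 1), ![r - 1, y + t - 1]) := by
  induction t generalizing y with
  | zero =>
    refine .of_step (F.step_divide_of_nonneg q y (by simpa using hr))
      (.of_step (F.step_divide_of_neg q _ (by simpa using hd)) ?_)
    convert Reaches.refl _ using 4 <;> push_cast <;> ring
  | succ t ih =>
    refine .of_step (F.step_divide_of_nonneg q y (by positivity)) ?_
    convert ih (y + 1) using 4 <;> push_cast <;> ring

theorem reaches_yes (q : Q) (x : ℤ) (t : ℕ) :
    F.toCounter.Reaches ((q, 2), ![x, t - 1]) ((F.yes q, 0), ![x + t * F.mul q, 0]) := by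
  induction t generalizing x with
  | zero => exact ⟨1, by simp [F.step_yes_of_neg]⟩
  | succ t ih =>
    refine .of_step (F.step_yes_of_nonneg q x (by simp)) ?_
    rw [show x + ((t + 1 : ℕ) : ℤ) * F.mul q = x + F.mul q + t * F.mul q by push_cast; ring,
      show ((t + 1 : ℕ) : ℤ) - 1 - 1 = t - 1 by push_cast; ring]
    exact ih _

theorem reaches_no (q : Q) (x : ℤ) (t : ℕ) :
    F.toCounter.Reaches ((q, 3), ![x, t - 1]) ((F.no q, 0), ![x + t * F.div q, 0]) := by
  induction t generalizing x with
  | zero => exact ⟨1, by simp [F.step_no_of_neg]⟩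
  | succ t ih =>
    refine .of_step (F.step_no_of_nonneg q x (by simp)) ?_
    rw [show x + ((t + 1 : ℕ) : ℤ) * F.div q = x + F.div q + t * F.div q by push_cast; ring,
      show ((t + 1 : ℕ) : ℤ) - 1 - 1 = t - 1 by push_cast; ring]
    exact ih _

theorem reaches_of_dvd {q : Q} {N : ℕ} (hd : 0 < F.div q) (h : F.div q ∣ N) :
    F.toCounter.Reaches ((q, 0), ![(N : ℤ), 0])
      ((F.yes q, 0), ![((N / F.div q * F.mul q : ℕ) : ℤ), 0]) := by
  obtain ⟨t, rfl⟩ := h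
  have h1 := F.reaches_divide (q := q) (r := 0) le_rfl (by exact_mod_cast hd) t 0
  have h2 := F.reaches_yes q 0 t
  rw [Nat.mul_div_cancel_left _ hd]
  simp only [zero_add, zero_sub] at h1 h2
  push_cast
  rw [mul_comm (F.div q : ℤ)]
  exact h1.trans (.of_step (F.step_test_of_neg q _ (by simp)) h2)

theorem reaches_of_not_dvd {q : Q} {N : ℕ} (hd : 0 < F.div q) (h : ¬ F.div q ∣ N) :
    F.toCounter.Reaches ((q, 0), ![(N : ℤ), 0]) ((F.no q, 0), ![(N : ℤ), 0]) := by
  have hr : N % F.div q ≠ 0 := fun h' => h (Nat.dvd_of_mod_eq_zero h')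
  have hN : ((N % F.div q : ℕ) : ℤ) + (N / F.div q : ℕ) * F.div q = N := by
    exact_mod_cast Nat.mod_add_div' N (F.div q)
  have h1 := F.reaches_divide (q := q) (r := (N % F.div q : ℕ)) (by positivity)
    (by exact_mod_cast Nat.mod_lt _ hd) (N / F.div q) 0
  have h2 := F.reaches_no q (N % F.div q : ℕ) (N / F.div q)
  rw [hN] at h1 h2
  rw [zero_add] at h1
  refine h1.trans (.of_step (F.step_test_of_nonneg q _ (by omega)) ?_)
  rwa [sub_add_cancel]

end FractionMachine

/-! ### Register programs on a counter machine -/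

/-- The `i`-th prime number, which stands for register `i`. -/
noncomputable def regPrime (i : ℕ) : ℕ := Nat.nth Nat.Prime i

theorem regPrime_prime (i : ℕ) : (regPrime i).Prime := Nat.prime_nth_prime i

theorem regPrime_injective : Injective regPrime := Nat.nth_injective Nat.infinite_setOfPred_prime

/-- `N` represents the register contents `s`: the exponent of the `i`-th prime in `N` is `s i`. -/
def Represents (N : ℕ) (s : ℕ → ℕ) : Prop := N ≠ 0 ∧ ∀ i, N.factorization (regPrime i) = s i

theorem Represents.mul {N : ℕ} {s : ℕ → ℕ} (h : Represents N s) (i : ℕ) :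
    Represents (N * regPrime i) (update s i (s i + 1)) := by
  have hp := regPrime_prime i
  refine ⟨mul_ne_zero h.1 hp.ne_zero, fun j => ?_⟩
  rw [Nat.factorization_mul h.1 hp.ne_zero, Finsupp.add_apply, h.2, hp.factorization,
    Finsupp.single_apply, update_apply]
  simp only [regPrime_injective.eq_iff]
  grind

theorem Represents.dvd_iff {N : ℕ} {s : ℕ → ℕ} (h : Represents N s) (i : ℕ) :
    regPrime i ∣ N ↔ s i ≠ 0 := by
  rw [← h.2, (regPrime_prime i).dvd_iff_one_le_factorization h.1, Nat.one_le_iff_ne_zero]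

theorem Represents.div {N : ℕ} {s : ℕ → ℕ} (h : Represents N s) {i : ℕ} (hi : s i ≠ 0) :
    Represents (N / regPrime i) (update s i (s i - 1)) := by
  have hd := (h.dvd_iff i).2 hi
  refine ⟨(Nat.div_pos (Nat.le_of_dvd (Nat.pos_of_ne_zero h.1) hd) (regPrime_prime i).pos).ne',
    fun j => ?_⟩
  rw [Nat.factorization_div hd, Finsupp.tsub_apply, h.2, (regPrime_prime i).factorization,
    Finsupp.single_apply, update_apply]
  simp only [regPrime_injective.eq_iff]
  grind

/-- Execution of register programs on a fraction machine, whose states are the lists of programs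
that remain to be executed. -/
noncomputable def progMachine : FractionMachine (List Prog) where
  div
    | .dec i :: _ => regPrime i
    | .loop i _ :: _ => regPrime i
    | _ => 1
  mul
    | .inc i :: _ => regPrime i
    | .loop i _ :: _ => regPrime i
    | _ => 1
  yes
    | [] => []
    | .inc _ :: K => K
    | .dec _ :: K => K
    | .seq p q :: K => p :: q :: K
    | .loop i p :: K => p :: .loop i p :: K
    | .halt :: K => .halt :: K
  no
    | [] => []
    | .inc _ :: K => K
    | .dec _ :: K => K
    | .seq p q :: K => p :: q :: K
    | .loop _ _ :: K => K
    | .halt :: K => .halt :: K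

open CounterMachine

/-- The counter machine carries out a terminating run of a register program, on representatives of
the register contents, and then turns to the remaining programs. -/
theorem Run.reaches {p : Prog} {s t : ℕ → ℕ} (h : Run p s t) (K : List Prog) {N : ℕ}
    (hN : Represents N s) : ∃ N', Represents N' t ∧
      progMachine.toCounter.Reaches ((p :: K, 0), ![(N : ℤ), 0]) ((K, 0), ![(N' : ℤ), 0]) := by
  induction h generalizing K N with
  | inc i s =>
    refine ⟨_, hN.mul i, ?_⟩
    simpa [progMachine] using progMachine.reaches_of_dvd (q := .inc i :: K) (N := N)
      (by simp [progMachine]) (by simp [progMachine])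
  | dec i s hi =>
    refine ⟨_, hN.div hi, ?_⟩
    simpa [progMachine] using progMachine.reaches_of_dvd (q := .dec i :: K) (N := N)
      (regPrime_prime i).pos ((hN.dvd_iff i).2 hi)
  | @seq p q s t u _ _ ihp ihq =>
    obtain ⟨N₁, h₁, r₁⟩ := ihp (q :: K) hN
    obtain ⟨N₂, h₂, r₂⟩ := ihq K h₁
    refine ⟨N₂, h₂, .trans ?_ (r₁.trans r₂)⟩
    simpa [progMachine] using progMachine.reaches_of_dvd (q := .seq p q :: K) (N := N)
      (by simp [progMachine]) (by simp [progMachine])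
  | @loop_zero i p s hi =>
    refine ⟨N, hN, ?_⟩
    exact progMachine.reaches_of_not_dvd (q := .loop i p :: K) (N := N)
      (regPrime_prime i).pos (fun h => (hN.dvd_iff i).1 h hi)
  | @loop_succ i p s t u hi _ _ ihp ihl =>
    obtain ⟨N₁, h₁, r₁⟩ := ihp (.loop i p :: K) hN
    obtain ⟨N₂, h₂, r₂⟩ := ihl K h₁
    refine ⟨N₂, h₂, .trans ?_ (r₁.trans r₂)⟩
    have hd := (hN.dvd_iff i).2 hi
    have := progMachine.reaches_of_dvd (q := .loop i p :: K) (N := N) (regPrime_prime i).pos hd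
    simpa only [progMachine, Nat.div_mul_cancel hd] using this

/-- The states of `progMachine` that occur in the execution of `p` followed by `K`, up to the end of
the execution of `p`. -/
def contStates : Prog → List Prog → Finset (List Prog)
  | .seq p q, K => insert (.seq p q :: K) (contStates p (q :: K) ∪ contStates q K)
  | .loop i p, K => insert (.loop i p :: K) (contStates p (.loop i p :: K))
  | p, K => {p :: K}

theorem cons_mem_contStates (p : Prog) (K : List Prog) : p :: K ∈ contStates p K := by
  cases p <;> simp [contStates]

/-- Only finitely many states occur in the execution of a program. -/
theorem contStates_closed (p : Prog) (K : List Prog) : ∀ L ∈ contStates p K,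
    progMachine.yes L ∈ insert K (contStates p K) ∧
      progMachine.no L ∈ insert K (contStates p K) := by
  induction p generalizing K with
  | inc i => simp [contStates, progMachine]
  | dec i => simp [contStates, progMachine]
  | halt => simp [contStates, progMachine]
  | seq p q ihp ihq =>
    have h1 := cons_mem_contStates p (q :: K)
    have h2 := cons_mem_contStates q K
    have ihp := ihp (q :: K)
    have ihq := ihq K
    simp only [contStates, Finset.mem_insert, Finset.mem_union] at *
    rintro L (rfl | h | h)
    · simp [progMachine, h1]
    · have := ihp L h
      grind
    · have := ihq L h
      grind
  | loop i p ih =>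
    have h1 := cons_mem_contStates p (.loop i p :: K)
    have ih := ih (.loop i p :: K)
    simp only [contStates, Finset.mem_insert] at *
    rintro L (rfl | h)
    · simp [progMachine, h1]
    · have := ih L h
      grind

/-! ### Undecidability of reachability for a fixed counter machine -/

/-- A partial recursive function with values `0` and `1` whose fibres are computably inseparable:
the diagonal of the universal function. -/
theorem exists_partrec_inseparable : ∃ f : ℕ →. ℕ, Partrec f ∧
    ∀ D : ℕ → Prop, ComputablePred D → ¬ ((∀ c, 1 ∈ f c → D c) ∧ ∀ c, 0 ∈ f c → ¬ D c) := by
  refine ⟨fun c => (Denumerable.ofNat Nat.Partrec.Code c).eval c,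
    Nat.Partrec.Code.eval_part.comp (Computable.ofNat _) Computable.id, ?_⟩
  rintro D hD ⟨h1, h0⟩
  -- A separating predicate fails at the index `e` of its own complement.
  obtain ⟨d, hd, rfl⟩ := ComputablePred.computable_iff.1 hD
  have hg : Computable fun n => cond (d n) 0 1 :=
    Computable.cond hd (Computable.const 0) (Computable.const 1)
  obtain ⟨e, he⟩ := Nat.Partrec.Code.exists_code.1 (Partrec.nat_iff.1 hg.partrec)
  have h : (Denumerable.ofNat Nat.Partrec.Code (Encodable.encode e)).eval (Encodable.encode e) =
      Part.some (cond (d (Encodable.encode e)) 0 1) := by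
    rw [Denumerable.ofNat_encode, he]
    rfl
  have h1 := h1 (Encodable.encode e)
  have h0 := h0 (Encodable.encode e)
  simp only [h, Part.mem_some_iff] at h1 h0
  cases hb : d (Encodable.encode e) <;> simp [hb] at h1 h0

/-- A finite counter machine with an undecidable reachability problem, where only the initial value
`2 ^ c` of the first counter varies. -/
theorem exists_undecidable_counterMachine :
    ∃ (Q : Type) (_ : Fintype Q) (M : CounterMachine Q) (acc : Q → Prop) (q₀ : Q),
      ¬ ∃ D : ℕ → Prop, ComputablePred D ∧
        ∀ c, D c ↔ ∃ n, acc (M.step^[n] (q₀, ![((2 ^ c : ℕ) : ℤ), 0])).1 := by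
  obtain ⟨f, hf, hsep⟩ := exists_partrec_inseparable
  obtain ⟨p, hp⟩ := Computes.of_partrec (Nat.Partrec'.part_iff₁.2 hf) (fun _ => 0) 1 2
    (by simp) (by simp) (by simp)
  -- After the computation of `f`, the result being in register `1`, the machine comes to rest in
  -- the state `A` if the result is nonzero and in the state `R` otherwise.
  let R : List Prog := [.halt]
  let L : List Prog := .loop 1 .halt :: R
  let A : List Prog := .halt :: L
  let S : Finset (List Prog) := contStates p L ∪ {L, A, R}
  have hS : ∀ K ∈ S, progMachine.yes K ∈ S ∧ progMachine.no K ∈ S := by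
    intro K hK
    simp only [S, Finset.mem_union, Finset.mem_insert, Finset.mem_singleton] at hK ⊢
    rcases hK with hK | rfl | rfl | rfl
    · have := contStates_closed p L K hK
      simp only [Finset.mem_insert] at this
      grind
    all_goals simp [progMachine, L, A, R]
  let T : Set (List Prog × Fin 4) := {x | x.1 ∈ S}
  have hT : ∀ q ∈ T, ∀ b, progMachine.toCounter.next q b ∈ T := by
    rintro ⟨K, i⟩ hK b
    have := hS K hK
    fin_cases i <;> simp only [FractionMachine.toCounter, T, Set.mem_ofPred_eq] at hK ⊢ <;>
      split_ifs <;> simp [hK, this]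
  have hfin : Finite T := by
    refine Set.Finite.subset ((S ×ˢ Finset.univ : Finset (List Prog × Fin 4))).finite_toSet ?_
    intro x hx
    simpa [T] using hx
  -- A state of rest is never left.
  have hrest : ∀ K : List Prog, ∀ q ∈ {x : List Prog × Fin 4 | x.1 = .halt :: K}, ∀ b,
      progMachine.toCounter.next q b ∈ {x : List Prog × Fin 4 | x.1 = .halt :: K} := by
    rintro K ⟨_, i⟩ rfl b
    fin_cases i <;> simp only [FractionMachine.toCounter, Set.mem_ofPred_eq] <;>
      split_ifs <;> simp [progMachine]
  have hq₀ : (p :: L, (0 : Fin 4)) ∈ T := by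
    simp [T, S, cons_mem_contStates]
  refine ⟨T, Fintype.ofFinite T, progMachine.toCounter.restrict T hT, fun q => q.1.1 = A,
    ⟨_, hq₀⟩, ?_⟩
  rintro ⟨D, hD, hDiff⟩
  have hval : ∀ q u n, ((progMachine.toCounter.restrict T hT).step^[n] (q, u)).1.1 =
      (progMachine.toCounter.step^[n] (q.1, u)).1 := fun q u n => by
    rw [← iterate_step_restrict hT]
    rfl
  simp only [hval] at hDiff
  have hrun : ∀ c v, v ∈ f c → ∃ N', Represents N' (update (update 0 0 c) 1 v) ∧
      progMachine.toCounter.Reaches ((p :: L, 0), ![((2 ^ c : ℕ) : ℤ), 0])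
        ((L, 0), ![(N' : ℤ), 0]) := by
    intro c v hv
    refine (hp (update 0 0 c) (fun j hj => ?_) (by simp) v ?_).reaches L ⟨by positivity, fun i => ?_⟩
    · rw [update_of_ne (by omega)]
      rfl
    · simpa [List.Vector.ofFn] using hv
    · have h2 : regPrime 0 = 2 := Nat.nth_prime_zero_eq_two
      rw [Nat.prime_two.factorization_pow, Finsupp.single_apply, ← h2, update_apply]
      simp only [regPrime_injective.eq_iff, Pi.zero_apply]
      grind
  refine hsep D hD ⟨fun c hc => (hDiff c).2 ?_, fun c hc hDc => ?_⟩
  · obtain ⟨N, hN, hr⟩ := hrun c 1 hc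
    have hd : regPrime 1 ∣ N := (hN.dvd_iff 1).2 (by simp)
    have hl := progMachine.reaches_of_dvd (q := L) (N := N) (regPrime_prime 1).pos hd
    obtain ⟨n, hn⟩ := hr.trans hl
    exact ⟨n, by rw [hn]; rfl⟩
  -- Both states of rest would be reached, and hence occupied at the same late time.
  · obtain ⟨N, hN, hr⟩ := hrun c 0 hc
    have hd : ¬ regPrime 1 ∣ N := fun h => (hN.dvd_iff 1).1 h (by simp)
    have hl := progMachine.reaches_of_not_dvd (q := L) (N := N) (regPrime_prime 1).pos hd
    obtain ⟨n, hn⟩ := hr.trans hl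
    obtain ⟨m, hm⟩ := (hDiff c).1 hDc
    have h1 := iterate_step_mem (hrest L) hm n
    have h2 := iterate_step_mem (hrest []) (c := progMachine.toCounter.step^[n] _)
      (by rw [hn]; rfl) m
    rw [← iterate_add_apply] at h1 h2
    rw [add_comm] at h1
    simp only [Set.mem_ofPred_eq] at h1 h2
    rw [h1] at h2
    simp [L] at h2

/-! ### Games that simulate a counter machine -/

theorem GCGMP.coop_univ (G : GCGMP) (Sp So : StrategyClass) (c : G.Con) (l : ℕ)
    (Γ : (ℕ → G.Con × G.Profile) → Prop) : G.Coop Sp So Finset.univ c l Γ ↔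
      ∃ σ : ∀ a, G.Strategy a, (∀ a, σ a ∈ Sp G a ∧ G.Consistent c l a (σ a)) ∧
        Γ (G.outcomePlay σ c l) := by
  constructor
  · rintro ⟨σ, hσ, h⟩
    refine ⟨fun a => σ ⟨a, Finset.mem_univ a⟩, fun a => hσ ⟨a, Finset.mem_univ a⟩, ?_⟩
    simpa using h (fun a => absurd (Finset.mem_univ _) a.2)
      (fun a => absurd (Finset.mem_univ _) a.2)
  · rintro ⟨σ, hσ, h⟩
    exact ⟨fun a => σ a, fun a => hσ a, fun τ _ => by simpa using h⟩

namespace CounterMachine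

variable {Q : Type} (M : CounterMachine Q) (acc : Q → Prop) [DecidablePred acc] {n : ℕ}

/-- The constraint that the variable `v` is nonnegative. -/
def nonneg {V : Type} (v : V) : AC V := ⟨.var v, .ge, .const 0⟩

theorem sat_nonneg {V : Type} (v : V) (η : V → ℚ) : (nonneg v).Sat η ↔ 0 ≤ η v := by
  simp [AC.Sat, nonneg, Cmp.Rel, ACTerm.eval]

/-- The game model in which guards force both agents to play the signs of their accumulated payoffs,
which are the counters of the machine.  The label of a state consists of `0` and, in the accepting
states, of `1`. -/
@[reducible] def guardedModel (e : Fin n ≃ Q) (hn : 0 < n) : GCGMP where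
  nAg := 2
  nSt := n
  nAct _ := 2
  out s α := e.symm (M.next (e s) α)
  label s := if acc (e s) then {0, 1} else {0}
  payoff a s α := M.add (e s) α a
  guard _ _ α := if α = 1 then .atom (nonneg ()) else .neg (.atom (nonneg ()))
  disc _ := 1
  nAg_pos := two_pos
  nSt_pos := hn
  nAct_pos _ := two_pos
  disc_mem _ := ⟨zero_le_one, le_rfl⟩
  guard_total _ _ x := by
    by_cases h : 0 ≤ x
    · exact ⟨1, by simpa [ACF.Sat, sat_nonneg] using h⟩
    · exact ⟨0, by simpa [ACF.Sat, sat_nonneg] using h⟩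

section Guarded

variable (e : Fin n ≃ Q) (hn : 0 < n)

/-- The configuration of the guarded model that stands for a configuration of the machine. -/
def guardedCon (c : Q × (Fin 2 → ℤ)) : (M.guardedModel acc e hn).Con :=
  (e.symm c.1, fun a => (c.2 a : ℚ))

theorem enabled_guardedCon (c : Q × (Fin 2 → ℤ)) (a α : Fin 2) :
    (M.guardedModel acc e hn).Enabled (M.guardedCon acc e hn c) a α ↔ α = signs c.2 a := by
  simp only [GCGMP.Enabled, guardedCon, signs]
  split_ifs with h1 h2 h2
  · simpa [h1, ACF.Sat, sat_nonneg] using h2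
  · simpa [h1, ACF.Sat, sat_nonneg] using h2
  · simpa [h1, ACF.Sat, sat_nonneg] using h2
  · have h3 : α = 0 := by omega
    simpa [h1, h3, ACF.Sat, sat_nonneg] using h2

theorem nextCon_guardedCon (c : Q × (Fin 2 → ℤ)) (l : ℕ) :
    (M.guardedModel acc e hn).nextCon (M.guardedCon acc e hn c) (signs c.2) l =
      M.guardedCon acc e hn (M.step c) := by
  refine Prod.ext ?_ (funext fun a => ?_)
  · simp [GCGMP.nextCon, guardedCon, step]
  · simp [GCGMP.nextCon, guardedCon, step]

/-- The only play from a given configuration: the run of the machine. -/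
def guardedPlay (c : Q × (Fin 2 → ℤ)) (i : ℕ) :
    (M.guardedModel acc e hn).Con × (M.guardedModel acc e hn).Profile :=
  (M.guardedCon acc e hn (M.step^[i] c), signs (M.step^[i] c).2)

theorem isPlay_guarded_iff (c : Q × (Fin 2 → ℤ)) (l : ℕ)
    (π : ℕ → (M.guardedModel acc e hn).Con × (M.guardedModel acc e hn).Profile) :
    (M.guardedModel acc e hn).IsPlay (M.guardedCon acc e hn c) l π ↔
      π = M.guardedPlay acc e hn c := by
  constructor
  · rintro ⟨h0, h⟩
    have hα : ∀ i c', (π i).1 = M.guardedCon acc e hn c' → (π i).2 = signs c'.2 := by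
      intro i c' hi
      funext a
      have := (h i).1 a
      rw [hi] at this
      exact (M.enabled_guardedCon acc e hn c' a _).1 this
    have hc : ∀ i, (π i).1 = M.guardedCon acc e hn (M.step^[i] c) := by
      intro i
      induction i with
      | zero => exact h0
      | succ i ih =>
        rw [(h i).2, hα i _ ih, ih, nextCon_guardedCon, iterate_succ_apply']
    exact funext fun i => Prod.ext (hc i) (hα i _ (hc i))
  · rintro rfl
    refine ⟨rfl, fun i => ⟨fun a => (M.enabled_guardedCon acc e hn _ a _).2 rfl, ?_⟩⟩
    simp only [guardedPlay]
    rw [nextCon_guardedCon, iterate_succ_apply']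

/-- All consistent strategy profiles have the run of the machine as their outcome. -/
theorem outcomeHist_guarded (c : Q × (Fin 2 → ℤ)) (l : ℕ)
    {σ : ∀ a, (M.guardedModel acc e hn).Strategy a}
    (hσ : ∀ a, (M.guardedModel acc e hn).Consistent (M.guardedCon acc e hn c) l a (σ a)) (i : ℕ) :
    (M.guardedModel acc e hn).outcomeHist σ (M.guardedCon acc e hn c) l i =
      ((List.range i).map (M.guardedPlay acc e hn c), (M.guardedPlay acc e hn c i).1) := by
  induction i with
  | zero => rfl
  | succ i ih =>
    have h : (fun a => σ a ((List.range i).map (M.guardedPlay acc e hn c),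
        (M.guardedPlay acc e hn c i).1)) = signs (M.step^[i] c).2 := by
      funext a
      exact (M.enabled_guardedCon acc e hn _ a _).1
        (hσ a _ ⟨_, (M.isPlay_guarded_iff acc e hn c l _).2 rfl, i, rfl⟩)
    simp only [GCGMP.outcomeHist, ih, h]
    refine Prod.ext ?_ ?_
    · rw [List.range_succ, List.map_append]
      rfl
    · simp only [guardedPlay]
      rw [nextCon_guardedCon, iterate_succ_apply']

theorem sat_prop_zero (c : Q × (Fin 2 → ℤ)) (l : ℕ) : (M.guardedModel acc e hn).Sat perfectRecall
    memoryless (.prop 0) (M.guardedCon acc e hn c) l := by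
  simp only [GCGMP.Sat]
  split_ifs <;> simp

theorem sat_prop_one (c : Q × (Fin 2 → ℤ)) (l : ℕ) : (M.guardedModel acc e hn).Sat perfectRecall
    memoryless (.prop 1) (M.guardedCon acc e hn c) l ↔ acc c.1 := by
  simp only [GCGMP.Sat, guardedCon, Equiv.apply_symm_apply]
  split_ifs with h <;> simp [h]

/-- In the guarded model, the grand coalition can reach an accepting state iff the machine does. -/
theorem sat_guarded (c : Q × (Fin 2 → ℤ)) :
    (M.guardedModel acc e hn).Sat perfectRecall memoryless
      (.coopU Finset.univ (.prop 0) (.prop 1)) (M.guardedCon acc e hn c) 1 ↔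
      ∃ i, acc (M.step^[i] c).1 := by
  have hΓ : ∀ σ : ∀ a, (M.guardedModel acc e hn).Strategy a,
      (∀ a, (M.guardedModel acc e hn).Consistent (M.guardedCon acc e hn c) 1 a (σ a)) →
      ((∃ j, (M.guardedModel acc e hn).Sat perfectRecall memoryless (.prop 1)
          ((M.guardedModel acc e hn).outcomePlay σ (M.guardedCon acc e hn c) 1 j).1 (1 + j) ∧
        ∀ i < j, (M.guardedModel acc e hn).Sat perfectRecall memoryless (.prop 0)
          ((M.guardedModel acc e hn).outcomePlay σ (M.guardedCon acc e hn c) 1 i).1 (1 + i)) ↔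
      ∃ i, acc (M.step^[i] c).1) := by
    intro σ hσ
    refine exists_congr fun j => ?_
    have hplay : ∀ i, ((M.guardedModel acc e hn).outcomePlay σ (M.guardedCon acc e hn c) 1 i).1 =
        M.guardedCon acc e hn (M.step^[i] c) := fun i =>
      congrArg Prod.snd (M.outcomeHist_guarded acc e hn c 1 hσ i)
    simp only [hplay, sat_prop_zero, sat_prop_one, implies_true, and_true]
  rw [GCGMP.Sat, GCGMP.coop_univ]
  constructor
  · rintro ⟨σ, hσ, h⟩
    exact (hΓ σ fun a => (hσ a).2).1 h
  · intro h
    -- Since the play is unique, the length of a history determines what is enabled after it.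
    let σ : ∀ a, (M.guardedModel acc e hn).Strategy a := fun a h =>
      signs (M.step^[(GCGMP.Hist.states h).length - 1] c).2 a
    have hσ : ∀ a, (M.guardedModel acc e hn).Consistent (M.guardedCon acc e hn c) 1 a (σ a) := by
      rintro a _ ⟨π, hπ, i, rfl⟩
      rw [isPlay_guarded_iff] at hπ
      subst hπ
      refine (M.enabled_guardedCon acc e hn _ a _).2 ?_
      simp [σ, GCGMP.Hist.states]
    exact ⟨σ, fun a => ⟨⟨fun L => signs (M.step^[L.length - 1] c).2 a, fun _ => rfl⟩, hσ a⟩,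
      (hΓ σ hσ).2 h⟩

end Guarded

/-- The game model in which the agents guess the signs of the next values of the counters.  A state
consists of a state of the machine and the guessed signs, which replace the true ones in the
transition.  The propositions `0` and `1` record the guesses, and `2` marks the accepting states. -/
@[reducible] def guessingModel (e : Fin n ≃ Q × (Fin 2 → Fin 2)) (hn : 0 < n) : GCGMP where
  nAg := 2
  nSt := n
  nAct _ := 2
  out s α := e.symm (M.next (e s).1 (e s).2, α)
  label s := (if acc (e s).1 then {2} else ∅) ∪
    (Finset.univ.filter fun a : Fin 2 => (e s).2 a = 1).image Fin.val
  payoff a s _ := M.add (e s).1 (e s).2 a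
  guard _ _ _ := .atom ⟨.const 0, .eq, .const 0⟩
  disc _ := 1
  nAg_pos := two_pos
  nSt_pos := hn
  nAct_pos _ := two_pos
  disc_mem _ := ⟨zero_le_one, le_rfl⟩
  guard_total _ _ x := ⟨0, by simp [ACF.Sat, AC.Sat, Cmp.Rel]⟩

/-- The guess recorded for the counter `a` is right: proposition `a` holds if and only if the
accumulated payoff of agent `a` is nonnegative. -/
def rightGuess (a : Fin 2) : Formula 2 :=
  .and (.neg (.and (.prop a) (.neg (.ac (nonneg a)))))
    (.neg (.and (.neg (.prop a)) (.ac (nonneg a))))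

section Guessing

variable (e : Fin n ≃ Q × (Fin 2 → Fin 2)) (hn : 0 < n)

/-- The configuration of the guessing model given by a configuration of the machine and guesses. -/
def guessingCon (c : Q × (Fin 2 → ℤ)) (g : Fin 2 → Fin 2) : (M.guessingModel acc e hn).Con :=
  (e.symm (c.1, g), fun a => (c.2 a : ℚ))

theorem nextCon_guessingCon (c : Q × (Fin 2 → ℤ)) (α : Fin 2 → Fin 2) (l : ℕ) :
    (M.guessingModel acc e hn).nextCon (M.guessingCon acc e hn c (signs c.2)) α l =
      M.guessingCon acc e hn (M.step c) α := by
  refine Prod.ext ?_ (funext fun a => ?_)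
  · simp [GCGMP.nextCon, guessingCon, step]
  · simp [GCGMP.nextCon, guessingCon, step]

theorem sat_rightGuess (c : Q × (Fin 2 → ℤ)) (g : Fin 2 → Fin 2) (l : ℕ) :
    (M.guessingModel acc e hn).Sat perfectRecall memoryless
      (.and (rightGuess 0) (rightGuess 1)) (M.guessingCon acc e hn c g) l ↔ g = signs c.2 := by
  have h : ∀ a : Fin 2, (M.guessingModel acc e hn).Sat perfectRecall memoryless (rightGuess a)
      (M.guessingCon acc e hn c g) l ↔ g a = signs c.2 a := by
    intro a
    have ha : a.val ∈ (M.guessingModel acc e hn).label (M.guessingCon acc e hn c g).1 ↔ g a = 1 := by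
      have h2 : a.val ≠ 2 := by omega
      simp only [guessingCon, Equiv.apply_symm_apply, Finset.mem_union, Finset.mem_image,
        Finset.mem_filter, Finset.mem_univ, true_and, Fin.val_inj, exists_eq_right]
      split_ifs <;> simp [h2]
    have hu : (nonneg a).Sat (M.guessingCon acc e hn c g).2 ↔ 0 ≤ c.2 a := by
      rw [sat_nonneg]
      exact Int.cast_nonneg_iff
    simp only [rightGuess, GCGMP.Sat, ha, hu, signs]
    split_ifs with h
    · simp [h]
    · simp only [h]
      generalize g a = x
      fin_cases x <;> simp
  refine (and_congr (h 0) (h 1)).trans ?_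
  rw [funext_iff, Fin.forall_fin_two]

theorem sat_prop_two (c : Q × (Fin 2 → ℤ)) (g : Fin 2 → Fin 2) (l : ℕ) :
    (M.guessingModel acc e hn).Sat perfectRecall memoryless (.prop 2)
      (M.guessingCon acc e hn c g) l ↔ acc c.1 := by
  simp only [GCGMP.Sat, guessingCon, Equiv.apply_symm_apply, Finset.mem_union, Finset.mem_image,
    Finset.mem_filter, Finset.mem_univ, true_and]
  constructor
  · rintro (h | ⟨a, -, h⟩)
    · by_contra h'
      simp [h'] at h
    · omega
  · intro h
    simp [h]

theorem length_outcomeHist (G : GCGMP) (σ : ∀ a, G.Strategy a) (c : G.Con) (l i : ℕ) :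
    (G.outcomeHist σ c l i).1.length = i := by
  induction i with
  | zero => rfl
  | succ i ih => simp [GCGMP.outcomeHist, ih]

/-- In the guessing model, the grand coalition can reach an accepting state, with right guesses until
then, iff the machine reaches one. -/
theorem sat_guessing (c : Q × (Fin 2 → ℤ)) :
    (M.guessingModel acc e hn).Sat perfectRecall memoryless
      (.coopU Finset.univ (.and (rightGuess 0) (rightGuess 1)) (.prop 2))
        (M.guessingCon acc e hn c (signs c.2)) 1 ↔ ∃ i, acc (M.step^[i] c).1 := by
  rw [GCGMP.Sat, GCGMP.coop_univ]
  constructor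
  · rintro ⟨σ, -, j, hj, hlt⟩
    have h : ∀ i ≤ j, ∃ g, ((M.guessingModel acc e hn).outcomePlay σ
        (M.guessingCon acc e hn c (signs c.2)) 1 i).1 = M.guessingCon acc e hn (M.step^[i] c) g := by
      intro i
      induction i with
      | zero => exact fun _ => ⟨_, rfl⟩
      | succ i ih =>
        intro hi
        obtain ⟨g, hg⟩ := ih (by omega)
        have hr := hlt i (by omega)
        rw [hg, sat_rightGuess] at hr
        subst hr
        refine ⟨((M.guessingModel acc e hn).outcomePlay σ
          (M.guessingCon acc e hn c (signs c.2)) 1 i).2, ?_⟩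
        rw [iterate_succ_apply', ← M.nextCon_guessingCon acc e hn _ _ (1 + i), ← hg]
        rfl
    obtain ⟨g, hg⟩ := h j le_rfl
    rw [hg, sat_prop_two] at hj
    exact ⟨j, hj⟩
  · rintro ⟨j, hj⟩
    -- After a history with `i` states, the signs to be guessed are those at time `i`.
    let f (a : Fin 2) (L : List (Fin n)) : Fin 2 := signs (M.step^[L.length] c).2 a
    let σ : ∀ a, (M.guessingModel acc e hn).Strategy a := fun a h => f a (GCGMP.Hist.states h)
    have h : ∀ i, ((M.guessingModel acc e hn).outcomePlay σ
        (M.guessingCon acc e hn c (signs c.2)) 1 i).1 =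
          M.guessingCon acc e hn (M.step^[i] c) (signs (M.step^[i] c).2) := by
      intro i
      induction i with
      | zero => rfl
      | succ i ih =>
        have hα : ((M.guessingModel acc e hn).outcomePlay σ
            (M.guessingCon acc e hn c (signs c.2)) 1 i).2 = signs (M.step^[i + 1] c).2 := by
          funext a
          simp [GCGMP.outcomePlay, σ, f, GCGMP.Hist.states, length_outcomeHist]
        rw [← hα, iterate_succ_apply', ← M.nextCon_guessingCon acc e hn _ _ (1 + i), ← ih]
        rfl
    refine ⟨σ, fun a => ⟨⟨f a, fun _ => rfl⟩, fun _ _ => ?_⟩, j, ?_, fun i _ => ?_⟩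
    · simp [GCGMP.Enabled, ACF.Sat, AC.Sat, Cmp.Rel]
    · rw [h, sat_prop_two]
      exact hj
    · rw [h, sat_rightGuess]

end Guessing

end CounterMachine

/-! ### Undecidability of model checking -/

/-- Model checking is undecidable on a class that contains, for a fixed model, state and formula with
two agents, all the instances in which the initial payoffs are `2 ^ c` and `0`, if it is undecidable
which of these instances are positive. -/
theorem not_modelCheckingDecidable {P : Instance → Prop} (I : ℕ → Instance) (hP : ∀ c, P (I c))
    (pre post : List ℕ) (hcode : ∀ c, (I c).code = pre ++ 2 ^ c :: post)
    (hI : ¬ ∃ D : ℕ → Prop, ComputablePred D ∧ ∀ c, D c ↔ (I c).Holds perfectRecall memoryless) :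
    ¬ ModelCheckingDecidable perfectRecall memoryless P := by
  rintro ⟨D, hD, h⟩
  refine hI ⟨fun c => D (pre ++ 2 ^ c :: post), ?_, fun c => by simpa only [← hcode] using h _ (hP c)⟩
  have hpow : Primrec fun c : ℕ => 2 ^ c :=
    (Primrec₂.unpaired'.1 Nat.Primrec.pow).comp (Primrec.const 2) Primrec.id
  have hlist : Primrec fun c : ℕ => pre ++ 2 ^ c :: post :=
    Primrec.list_append.comp (Primrec.const pre) (Primrec.list_cons.comp hpow (Primrec.const post))
  exact ComputablePred.computable_of_manyOneReducible ⟨_, hlist.to_comp, fun c => Iff.rfl⟩ hD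

theorem code_eq (G : GCGMP) (s : Fin G.nSt) (φ : Formula G.nAg) (u : Fin G.nAg → ℤ) :
    (Instance.mk G s u φ).code =
      (G.code ++ [s.val]) ++ (table (fun a => codeInt (u a)) ++ φ.code) := by
  simp [Instance.code]

theorem table_initial (c : ℕ) :
    (table fun a => codeInt (![((2 ^ c : ℕ) : ℤ), 0] a)) = [2 ^ c, 0, 0, 0] := by
  generalize 2 ^ c = N
  simp [table, codeInt]

end NGL

theorem mainTheorem1 :
    ¬ NGL.ModelCheckingDecidable NGL.perfectRecall NGL.memoryless (fun _ => True) ∧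
    ¬ NGL.ModelCheckingDecidable NGL.perfectRecall NGL.memoryless
      (fun I => I.M.nAg = 2 ∧ I.φ.NoNesting ∧ I.φ.NoArith) ∧
    ¬ NGL.ModelCheckingDecidable NGL.perfectRecall NGL.memoryless
      (fun I => I.M.nAg = 2 ∧ I.φ.NoNesting ∧ I.M.StateBasedGuards) := by
  classical
  obtain ⟨Q, _, M, acc, q₀, hM⟩ := NGL.exists_undecidable_counterMachine
  have h1 : ¬ NGL.ModelCheckingDecidable NGL.perfectRecall NGL.memoryless
      (fun I => I.M.nAg = 2 ∧ I.φ.NoNesting ∧ I.φ.NoArith) := by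
    let e : Fin (Fintype.card Q) ≃ Q := (Fintype.equivFin Q).symm
    have hn : 0 < Fintype.card Q := Fintype.card_pos_iff.2 ⟨q₀⟩
    refine NGL.not_modelCheckingDecidable (fun c => ⟨M.guardedModel acc e hn, e.symm q₀,
      ![((2 ^ c : ℕ) : ℤ), 0], .coopU Finset.univ (.prop 0) (.prop 1)⟩)
      (fun c => ⟨rfl, by simp [NGL.Formula.NoNesting, NGL.Formula.NoCoop],
        by simp [NGL.Formula.NoArith]⟩) _ _
      (fun c => by rw [NGL.code_eq, NGL.table_initial]; rfl) ?_
    rintro ⟨D, hD, h⟩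
    exact hM ⟨D, hD, fun c => (h c).trans (M.sat_guarded acc e hn (q₀, _))⟩
  refine ⟨fun ⟨D, hD, h⟩ => h1 ⟨D, hD, fun I _ => h I trivial⟩, h1, ?_⟩
  let e : Fin (Fintype.card (Q × (Fin 2 → Fin 2))) ≃ Q × (Fin 2 → Fin 2) :=
    (Fintype.equivFin _).symm
  have hn : 0 < Fintype.card (Q × (Fin 2 → Fin 2)) := Fintype.card_pos_iff.2 ⟨(q₀, 1)⟩
  refine NGL.not_modelCheckingDecidable (fun c => ⟨M.guessingModel acc e hn, e.symm (q₀, 1),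
    ![((2 ^ c : ℕ) : ℤ), 0], .coopU Finset.univ
      (.and (NGL.CounterMachine.rightGuess 0) (NGL.CounterMachine.rightGuess 1)) (.prop 2)⟩)
    (fun c => ⟨rfl, by simp [NGL.Formula.NoNesting, NGL.Formula.NoCoop, NGL.CounterMachine.rightGuess],
      fun a s α => ⟨trivial, trivial⟩⟩) _ _
    (fun c => by rw [NGL.code_eq, NGL.table_initial]; rfl) ?_
  rintro ⟨D, hD, h⟩
  refine hM ⟨D, hD, fun c => (h c).trans ?_⟩
  -- The initial guesses are right, since both initial payoffs are nonnegative.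
  have hs : NGL.CounterMachine.signs ![((2 ^ c : ℕ) : ℤ), 0] = 1 := by
    funext a
    fin_cases a <;> simp [NGL.CounterMachine.signs]
  rw [← M.sat_guessing acc e hn (q₀, _), hs]
  rfl
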